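/- **Setting.** Let $n,d\ge 1$ and $f(x)=\frac1n\sum_{i=1}^n f_i(x)$ on $\mathbb R^d$, where each $f_i$ is differentiable and convex with $L$-Lipschitz gradient $f_i'$ and $f$ is $\mu$-strongly convex ($L,\mu>0$); let $x^*$ be the minimizer of $f$ and $\kappa:=L/\mu$. Let $S_i$ be the set of coordinates where $f_i'$ is not identically zero, $p_v:=\frac1n|\{i: v\in S_i\}|$ and $\Delta:=\max_v p_v$. Let $$a^*(\tau):=\frac{1}{32\,(1+\tau\sqrt\Delta)\,\xi(\kappa,\Delta,\tau)},\qquad \xi(\kappa,\Delta,\tau):=\sqrt{1+\tfrac1{8\kappa}\min\{\tfrac1{\sqrt\Delta},\tau\}}.$$ **Algorithm.** ASAGA with step size $\gamma$ keeps in shared memory a vector $x$ (initially $x_0$) and vectors $\alpha_1,\dots,\alpha_n$ (initially $\alpha_i^0$, supported on $S_i$). Iterations are executed concurrently by several cores. Iteration $t$ reads, coordinate by coordinate and without locks, the vector $\hat x_t$ from $x$ and $\hat\alpha_j^t$ from every $\alpha_j$; when all these reads are complete it samples $i_t$ uniformly in $\{1,\dots,n\}$, independently of everything read so far by iterations $\le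 t$ and of the indices of the earlier iterations; then, for each $v\in S_{i_t}$, it adds $-\gamma\big[f_{i_t}'(\hat x_t)-\hat\alpha^t_{i_t}\big]_v-\frac{\gamma}{p_v}\big[\frac1n\sum_k\hat\alpha_k^t\big]_v$ atomically to $[x]_v$ and overwrites $[\alpha_{i_t}]_v$ by $[f_{i_t}'(\hat x_t)]_v$. Iterations are labelled $t=0,1,2,\dots$ in the order in which they complete their reads. The integer $\tau\ge0$ is an overlap bound: iteration $t$ has finished all its writes before any iteration $r\ge t+\tau+1$ starts to read. We say that ASAGA converges geometrically with rate factor $\rho\in(0,1)$ if, for all $t\ge0$, $f(\hat x_t)$ is integrable and $$\mathbb E f(\hat x_t)-f(x^*)\le(1-\rho)^t\,K\,\frac n\gamma\,\Big(\|x_0-x^*\|^2+\frac1{5L^2}\sum_{i=1}^n\|\alpha_i^0-f_i'(x^*)\|^2\Big).$$ **Corollary (speedup condition for ASAGA).** For every $C>0$ the following hold. 1. There are $c,K>0$ depending only on $C$ such that, for all problems as above and all $\tau$ with $\tau\le n/10$ and $\tau\le C\,\frac1{\sqrt\Delta}\max\{1,\frac n\kappa\}$, every run of ASAGA with step size $\gamma=a^*(\tau)/L$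 and overlap bound $\tau$ converges geometrically with a rate factor $\rho\ge c\min\{\frac1n,\frac1\kappa\}$ (the same $\rho$ for all runs). 2. There are $\theta,c,K>0$ depending only on $C$ such that, for all problems as above and all $\tau$ with $\tau\le C\,\frac1{\sqrt\Delta}$, every run of ASAGA with the universal step size $\gamma=\theta/L$ (whose choice does not require $\kappa$) and overlap bound $\tau$ converges geometrically with a rate factor $\rho\ge c\min\{\frac1n,\frac1\kappa\}$ (the same $\rho$ for all runs). In both cases ASAGA has a linear speedup over sequential SAGA in terms of guaranteed rate factors per iteration: $\rho\ge c\cdot\frac15\min\{\frac1n,\frac a\kappa\}$ for every $a\in(0,1]$, where $\frac15\min\{\frac1n,\frac a\kappa\}$ is the guaranteed rate factor of sequential SAGA with step size $\frac a{5L}$. -/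

import Mathlib

open MeasureTheory ProbabilityTheory

namespace Asaga

noncomputable section

/-- The parameter space `ℝ^d` with its Euclidean norm. -/
abbrev Vec (d : ℕ) : Type := EuclideanSpace ℝ (Fin d)

/-! ### The finite-sum problem -/

/-- The objective `f = (1/n) ∑ i, f_i`. -/
def objective {n d : ℕ} (f : Fin n → Vec d → ℝ) (x : Vec d) : ℝ :=
  (1 / (n : ℝ)) * ∑ i, f i x

/-- Every `f_i` is differentiable and convex with `L`-Lipschitz gradient, and the objective is
`μ`-strongly convex. -/
structure IsProblem {n d : ℕ} (f : Fin n → Vec d → ℝ) (L μ : ℝ) : Prop where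
  L_pos : 0 < L
  mu_pos : 0 < μ
  differentiable : ∀ i, Differentiable ℝ (f i)
  convex : ∀ i, ConvexOn ℝ Set.univ (f i)
  lipschitz_gradient : ∀ i x y, ‖gradient (f i) x - gradient (f i) y‖ ≤ L * ‖x - y‖
  strongly_convex : StrongConvexOn Set.univ μ (objective f)

/-- `S_i`: the coordinates where the gradient of `f_i` can be nonzero. -/
def supp {n d : ℕ} (f : Fin n → Vec d → ℝ) (i : Fin n) : Set (Fin d) :=
  {v | ∃ x, gradient (f i) x v ≠ 0}

open scoped Classical in
/-- The number of indices `i` with `v ∈ S_i`. -/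
def featureDegree {n d : ℕ} (f : Fin n → Vec d → ℝ) (v : Fin d) : ℕ :=
  (Finset.univ.filter fun i : Fin n => v ∈ supp f i).card

/-- `p_v`: the probability that `v ∈ S_i` for a uniformly random index `i`. -/
def featureProb {n d : ℕ} (f : Fin n → Vec d → ℝ) (v : Fin d) : ℝ :=
  (featureDegree f v : ℝ) / n

/-- The sparsity measure `Δ = (max_v |{i : v ∈ S_i}|) / n`. -/
def sparsity {n d : ℕ} (f : Fin n → Vec d → ℝ) : ℝ :=
  ((Finset.univ.sup fun v : Fin d => featureDegree f v : ℕ) : ℝ) / n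

/-! ### Step size and rate constants -/

/-- `ξ(κ, Δ, τ) = √(1 + (1/(8κ)) min{1/√Δ, τ})`. -/
def xi (κ Δ τ : ℝ) : ℝ := √(1 + 1 / (8 * κ) * min (1 / √Δ) τ)

/-- `a*(τ) = 1 / (32 (1 + τ √Δ) ξ(κ, Δ, τ))`. -/
def aStar (κ Δ τ : ℝ) : ℝ := 1 / (32 * (1 + τ * √Δ) * xi κ Δ τ)

/-- The geometric rate factor of sequential (Sparse) SAGA with step size `a / (5L)`, `a ≤ 1`. -/
def sagaRate (n : ℕ) (κ a : ℝ) : ℝ := 1 / 5 * min (1 / (n : ℝ)) (a * (1 / κ))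

/-- `C₀ = ‖x₀ - x*‖² + (1/(5L²)) ∑ i, ‖α_i⁰ - f_i'(x*)‖²`. -/
def initialError {n d : ℕ} (f : Fin n → Vec d → ℝ) (L : ℝ) (xstar x₀ : Vec d)
    (α₀ : Fin n → Vec d) : ℝ :=
  ‖x₀ - xstar‖ ^ 2 + 1 / (5 * L ^ 2) * ∑ i, ‖α₀ i - gradient (f i) xstar‖ ^ 2

/-! ### The algorithm -/

open scoped Classical in
/-- The update direction `g(x, α, i) = f_i'(x) - α_i + D_i ((1/n) ∑ k, α_k)`, restricted to `S_i`,
where `D_i` is the projection onto `S_i` of the diagonal reweighting by `1 / p_v`. -/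
def direction {n d : ℕ} (f : Fin n → Vec d → ℝ) (x : Vec d) (α : Fin n → Vec d) (i : Fin n) :
    Vec d :=
  WithLp.toLp 2 fun v =>
    if v ∈ supp f i then
      gradient (f i) x v - α i v + (1 / featureProb f v) * ((1 / (n : ℝ)) * ∑ k, α k v)
    else 0

/-- The times of the shared-memory events of an asynchronous execution. Iteration `t` starts at
`start t`, reads the coordinate `v` of the parameter `x` at `readX t v` and the coordinate `v` of
the historical gradient `α_j` at `readMem t j v`, and has completed all its reads at `readDone t`.
It then samples an index `i`, adds its update to the coordinate `v ∈ S_i` of `x` at `writeX t v`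
(atomically), overwrites the coordinate `v ∈ S_i` of `α_i` at `writeMem t v`, and ends at
`finish t`. (For `v ∉ S_i` nothing is written and the write times play no role.) -/
structure Schedule (n d : ℕ) where
  start : ℕ → ℝ
  readX : ℕ → Fin d → ℝ
  readMem : ℕ → Fin n → Fin d → ℝ
  readDone : ℕ → ℝ
  writeX : ℕ → Fin d → ℝ
  writeMem : ℕ → Fin d → ℝ
  finish : ℕ → ℝ

/-- Within each iteration the events occur in the order start, reads, end of reads, writes, finish,
and iterations are labelled in the order in which they complete their reads (the "after read"
labelling). Reads and writes of different iterations may interleave arbitrarily. -/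
structure Schedule.AfterRead {n d : ℕ} (s : Schedule n d) : Prop where
  start_le_readX : ∀ t v, s.start t ≤ s.readX t v
  start_le_readMem : ∀ t j v, s.start t ≤ s.readMem t j v
  readX_le : ∀ t v, s.readX t v ≤ s.readDone t
  readMem_le : ∀ t j v, s.readMem t j v ≤ s.readDone t
  lt_writeX : ∀ t v, s.readDone t < s.writeX t v
  lt_writeMem : ∀ t v, s.readDone t < s.writeMem t v
  writeX_le_finish : ∀ t v, s.writeX t v ≤ s.finish t
  writeMem_le_finish : ∀ t v, s.writeMem t v ≤ s.finish t
  labels : Monotone s.readDone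

/-- Overlap bound `τ`: iteration `t` is over before any iteration `r ≥ t + τ + 1` starts. -/
def Schedule.OverlapBound {n d : ℕ} (s : Schedule n d) (τ : ℕ) : Prop :=
  ∀ t r, t + τ + 1 ≤ r → s.finish t < s.start r

open scoped Classical in
/-- For the schedule `s` and the sampled indices `idx`, the vectors `xhat t` and `αhat t j` are the
inconsistent reads of the shared `x` and `α_j` by iteration `t`:
* each coordinate of `x` holds its initial value plus all the updates added to it before the read;
* each coordinate of `α_j` holds the value last written to it before the read (its initial value if
  there is none). -/
structure IsExecution {n d : ℕ} (f : Fin n → Vec d → ℝ) (γ : ℝ) (x₀ : Vec d)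
    (α₀ : Fin n → Vec d) (s : Schedule n d) (idx : ℕ → Fin n) (xhat : ℕ → Vec d)
    (αhat : ℕ → Fin n → Vec d) : Prop where
  read_x : ∀ t v, xhat t v = x₀ v - γ *
    ∑ u ∈ (Finset.range t).filter (fun u => v ∈ supp f (idx u) ∧ s.writeX u v < s.readX t v),
      direction f (xhat u) (αhat u) (idx u) v
  read_mem : ∀ t j v,
    ((∀ u, ¬ (idx u = j ∧ v ∈ supp f j ∧ s.writeMem u v < s.readMem t j v)) ∧
      αhat t j v = α₀ j v) ∨
    ∃ u, (idx u = j ∧ v ∈ supp f j ∧ s.writeMem u v < s.readMem t j v) ∧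
      (∀ w, idx w = j → s.writeMem w v < s.readMem t j v → s.writeMem w v ≤ s.writeMem u v) ∧
      αhat t j v = gradient (f j) (xhat u) v

/-- The past of iteration `t` at the moment when its reads are complete: everything read so far and
the indices of the earlier iterations. -/
def history {n d : ℕ} {Ω : Type*} (idx : ℕ → Ω → Fin n) (xhat : ℕ → Ω → Vec d)
    (αhat : ℕ → Ω → Fin n → Vec d) (t : ℕ) (ω : Ω) :
    (Fin (t + 1) → Vec d × (Fin n → Vec d)) × (Fin t → Fin n) :=
  (fun s => (xhat s ω, αhat s ω), fun s => idx s ω)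

/-- A run of ASAGA with step size `γ`, from `x₀` and `α₀`, with overlap bound `τ`. The schedule is
random and may depend on the sampled indices; the index of iteration `t` is drawn uniformly once
the reads of iteration `t` are complete, so it is independent of the past at that moment. -/
structure IsRun {n d : ℕ} (f : Fin n → Vec d → ℝ) (γ : ℝ) (x₀ : Vec d) (α₀ : Fin n → Vec d)
    (τ : ℕ) {Ω : Type*} [MeasurableSpace Ω] (P : Measure Ω) (sched : Ω → Schedule n d)
    (idx : ℕ → Ω → Fin n) (xhat : ℕ → Ω → Vec d) (αhat : ℕ → Ω → Fin n → Vec d) : Prop where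
  measurable_idx : ∀ t, Measurable (idx t)
  measurable_xhat : ∀ t, Measurable (xhat t)
  measurable_αhat : ∀ t, Measurable (αhat t)
  after_read : ∀ ω, (sched ω).AfterRead
  overlap : ∀ ω, (sched ω).OverlapBound τ
  execution : ∀ ω, IsExecution f γ x₀ α₀ (sched ω) (fun t => idx t ω) (fun t => xhat t ω)
    (fun t => αhat t ω)
  uniform : ∀ t i, P (idx t ⁻¹' {i}) = (n : ENNReal)⁻¹
  indep : ∀ t, IndepFun (history idx xhat αhat t) (idx t) P

/-- `𝔼 f(x̂_t) - f(x*) ≤ (1 - ρ)^t B` for all `t`. -/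
def ConvergesAtRate {n d : ℕ} (f : Fin n → Vec d → ℝ) (xstar : Vec d) {Ω : Type*}
    [MeasurableSpace Ω] (P : Measure Ω) (xhat : ℕ → Ω → Vec d) (ρ B : ℝ) : Prop :=
  ∀ t, Integrable (fun ω => objective f (xhat t ω)) P ∧
    (∫ ω, objective f (xhat t ω) ∂P) - objective f xstar ≤ (1 - ρ) ^ t * B

end

end Asaga

/-!
A run is analysed through the virtual iterates `x_t = x₀ - γ ∑_{u < t} g_u`, where `g_u` is the
update direction of iteration `u`. Since the index of iteration `t` is independent of what has been
read by then, `g_t` is an unbiased estimate of `f'(x̂_t)`, and expanding `‖x_{t+1} - x*‖²` gives, for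
every `σ ≤ μ`, the recursion `IsRun.integral_sq_iterate_succ_le`: the mean squared distance of `x_t`
to `x*` contracts by `1 - γσ/2` and decreases by twice `γ (E f(x̂_t) - f(x*))`, up to second moments
of `g_t` and of the `g_u` that the read `x̂_t` may have missed. The overlap bound leaves only
`t - τ ≤ u < t`, and sparsity makes the cross terms small: the update of iteration `t` touches a
given coordinate with probability at most `Δ`, independently of `g_u`, so that
`E ∑_v |g_u|_v |g_t|_v ≤ (√Δ/2) (E‖g_u‖² + E‖g_t‖²)` (`IsRun.integral_sum_abs_mul_abs_le`).

The second moment of `g_t` is at most `4L` times the expected suboptimality of `x̂_t` plus twice the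
error of the stored gradients (`IsRun.stepMoment_le`). The latter is a discounted sum of the past
suboptimalities, because a stored gradient survives `k` iterations with probability about
`(1 - 1/n)^k`, up to a delay of `2τ` (`IsRun.memError_le`).

Multiplying the recursion by `(1 - ρ)^{-(t+1)}` and summing over `t`, all the second moments are
absorbed by the suboptimality terms when `γ` is small; what remains is the geometric bound
`excess_le_of_recursion`. The constants then come down to two facts. For `γ = a*(τ)/L` the factor
`ξ` is exactly what controls the term due to `σ = μ` (`aStar_mul_le`), and `a*(τ)` is at least a
constant over `max 1 (n/κ)` (`le_aStar`). For `γ = θ/L` one takes `σ = min μ (L/n)`: the rate is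
not better than `1/n` anyway, and `τ = O(1/√Δ) = O(n)` controls the same term.

For a fixed `t`, all the random variables of a run take finitely many values, so integrability and
measurability are never an issue (`IsRun.integrable_of_past`).
-/

/-! ### Smooth convex functions -/

section SmoothConvex

open scoped InnerProductSpace

variable {F : Type*} [NormedAddCommGroup F] [InnerProductSpace ℝ F] [CompleteSpace F] {f : F → ℝ}

theorem hasDerivAt_comp_line (hf : Differentiable ℝ f) (x d : F) (t : ℝ) :
    HasDerivAt (fun s : ℝ => f (x + s • d)) ⟪gradient f (x + t • d), d⟫_ℝ t := by
  have h1 : HasDerivAt (fun s : ℝ => x + s • d) d t := by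
    simpa using ((hasDerivAt_id t).smul_const d).const_add x
  have h2 := (hf (x + t • d)).hasGradientAt.hasFDerivAt.comp_hasDerivAt t h1
  refine h2.congr_deriv ?_
  simp

theorem ConvexOn.add_inner_gradient_le (hf : Differentiable ℝ f) (hc : ConvexOn ℝ Set.univ f)
    (x y : F) : f x + ⟪gradient f x, y - x⟫_ℝ ≤ f y := by
  have hφ : ConvexOn ℝ Set.univ (fun s : ℝ => f (x + s • (y - x))) := by
    have h := hc.comp_affineMap (AffineMap.lineMap x y)
    have he : (f ∘ (AffineMap.lineMap x y : ℝ →ᵃ[ℝ] F)) = fun s : ℝ => f (x + s • (y - x)) := by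
      funext s
      simp [AffineMap.lineMap_apply, add_comm]
    rwa [he, Set.preimage_univ] at h
  have h := hφ.le_slope_of_hasDerivAt (Set.mem_univ 0) (Set.mem_univ 1) zero_lt_one
    (hasDerivAt_comp_line hf x (y - x) 0)
  simp only [slope_def_field, zero_smul, add_zero, one_smul, add_sub_cancel, sub_zero,
    div_one] at h
  linarith

/-- The descent lemma. -/
theorem le_add_inner_gradient_add_sq (hf : Differentiable ℝ f) {L : ℝ}
    (hL : ∀ x y, ‖gradient f x - gradient f y‖ ≤ L * ‖x - y‖) (x y : F) :
    f y ≤ f x + ⟪gradient f x, y - x⟫_ℝ + L / 2 * ‖y - x‖ ^ 2 := by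
  set d := y - x with hd
  have hder : ∀ t : ℝ, HasDerivAt
      (fun s : ℝ => f (x + s • d) - s * ⟪gradient f x, d⟫_ℝ - L / 2 * s ^ 2 * ‖d‖ ^ 2)
      (⟪gradient f (x + t • d), d⟫_ℝ - ⟪gradient f x, d⟫_ℝ - L * t * ‖d‖ ^ 2) t := by
    intro t
    have h1 := hasDerivAt_comp_line hf x d t
    have h2 := (hasDerivAt_id t).mul_const ⟪gradient f x, d⟫_ℝ
    have h3 := (((hasDerivAt_pow 2 t).const_mul (L / 2)).mul_const (‖d‖ ^ 2))
    refine ((h1.sub h2).sub h3).congr_deriv ?_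
    push_cast
    ring
  have hanti := antitoneOn_of_deriv_nonpos (convex_Icc (0 : ℝ) 1)
    (fun t _ => (hder t).continuousAt.continuousWithinAt)
    (fun t _ => (hder t).differentiableAt.differentiableWithinAt) (by
      intro t ht
      rw [interior_Icc] at ht
      rw [(hder t).deriv, ← inner_sub_left]
      have h1 := real_inner_le_norm (gradient f (x + t • d) - gradient f x) d
      have h2 := hL (x + t • d) x
      rw [add_sub_cancel_left, norm_smul, Real.norm_of_nonneg ht.1.le] at h2
      have h3 := mul_le_mul_of_nonneg_right h2 (norm_nonneg d)
      nlinarith)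
  have h := hanti (Set.left_mem_Icc.2 zero_le_one) (Set.right_mem_Icc.2 zero_le_one) zero_le_one
  simp only [one_smul, zero_smul, add_zero, one_mul, zero_mul] at h
  rw [hd, add_sub_cancel] at h
  rw [hd]
  linarith

/-- Co-coercivity, in terms of the Bregman divergence of `f`. -/
theorem ConvexOn.sq_norm_gradient_sub_le (hf : Differentiable ℝ f) (hc : ConvexOn ℝ Set.univ f)
    {L : ℝ} (hL0 : 0 < L) (hL : ∀ x y, ‖gradient f x - gradient f y‖ ≤ L * ‖x - y‖) (x y : F) :
    ‖gradient f x - gradient f y‖ ^ 2 ≤ 2 * L * (f x - f y - ⟪gradient f y, x - y⟫_ℝ) := by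
  set g := gradient f x - gradient f y with hg
  -- the point reached from `x` by a gradient step for `f - ⟪f' y, ·⟫`
  set z := x - (1 / L) • g with hz
  have h1 := hc.add_inner_gradient_le hf y z
  have h2 := le_add_inner_gradient_add_sq hf hL x z
  have hzx : z - x = -((1 / L) • g) := by rw [hz]; abel
  have hzy : z - y = (x - y) + (z - x) := by abel
  rw [hzy, inner_add_right] at h1
  have h3 : ⟪gradient f x, z - x⟫_ℝ - ⟪gradient f y, z - x⟫_ℝ = -(1 / L) * ‖g‖ ^ 2 := by
    rw [← inner_sub_left, ← hg, hzx, inner_neg_right, real_inner_smul_right,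
      real_inner_self_eq_norm_sq]
    ring
  have h4 : L / 2 * ‖z - x‖ ^ 2 = 1 / (2 * L) * ‖g‖ ^ 2 := by
    rw [hzx, norm_neg, norm_smul, mul_pow, Real.norm_of_nonneg (by positivity)]
    field_simp
  have h5 : (1 / (2 * L)) * ‖g‖ ^ 2 ≤ f x - f y - ⟪gradient f y, x - y⟫_ℝ := by
    have h6 : -(1 / L) * ‖g‖ ^ 2 = -2 * (1 / (2 * L) * ‖g‖ ^ 2) := by field_simp
    linarith
  have h7 := mul_le_mul_of_nonneg_left h5 (by positivity : 0 ≤ 2 * L)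
  rwa [← mul_assoc, mul_one_div_cancel (by positivity), one_mul] at h7

theorem StrongConvexOn.add_inner_gradient_le {σ : ℝ} (hf : Differentiable ℝ f)
    (hc : StrongConvexOn Set.univ σ f) (x y : F) :
    f x + ⟪gradient f x, y - x⟫_ℝ + σ / 2 * ‖y - x‖ ^ 2 ≤ f y := by
  have hconv := strongConvexOn_iff_convex.1 hc
  have hgrad : HasGradientAt (fun z => f z - σ / 2 * ‖z‖ ^ 2) (gradient f x - σ • x) x := by
    rw [hasGradientAt_iff_hasFDerivAt]
    have h1 := (hf x).hasGradientAt.hasFDerivAt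
    have h2 := ((hasStrictFDerivAt_norm_sq x).hasFDerivAt).const_mul (σ / 2)
    refine (h1.sub h2).congr_fderiv ?_
    ext v
    simp only [_root_.sub_apply, InnerProductSpace.toDual_apply_apply,
      _root_.smul_apply, innerSL_apply_apply, smul_eq_mul, nsmul_eq_mul,
      inner_sub_left, real_inner_smul_left]
    push_cast
    ring
  have hdiff : Differentiable ℝ (fun z => f z - σ / 2 * ‖z‖ ^ 2) :=
    hf.sub ((contDiff_norm_sq ℝ).differentiable (n := 1) (by norm_num) |>.const_mul _)
  have h := hconv.add_inner_gradient_le hdiff x y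
  rw [hgrad.gradient, inner_sub_left, real_inner_smul_left] at h
  have h2 : ‖y‖ ^ 2 = ‖x‖ ^ 2 + 2 * ⟪x, y - x⟫_ℝ + ‖y - x‖ ^ 2 := by
    rw [← norm_add_sq_real, add_sub_cancel]
  rw [h2] at h
  linarith

end SmoothConvex

/-! ### The finite-sum objective -/

namespace Asaga

open scoped InnerProductSpace

variable {n d : ℕ} {f : Fin n → Vec d → ℝ} {L μ : ℝ} {xstar : Vec d}

namespace IsProblem

theorem differentiable_objective (hf : IsProblem f L μ) : Differentiable ℝ (objective f) :=
  (Differentiable.fun_sum fun i _ => hf.differentiable i).const_mul (1 / (n : ℝ))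

theorem gradient_objective (hf : IsProblem f L μ) (x : Vec d) :
    gradient (objective f) x = (1 / (n : ℝ)) • ∑ i, gradient (f i) x := by
  refine HasGradientAt.gradient ?_
  rw [hasGradientAt_iff_hasFDerivAt]
  have h := (HasFDerivAt.fun_sum fun i (_ : i ∈ Finset.univ) =>
    (hf.differentiable i x).hasGradientAt.hasFDerivAt).const_mul (1 / (n : ℝ))
  refine h.congr_fderiv ?_
  simp

theorem gradient_objective_minimizer (hmin : ∀ x, objective f xstar ≤ objective f x) :
    gradient (objective f) xstar = 0 := by
  have h : IsLocalMin (objective f) xstar := Filter.Eventually.of_forall hmin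
  simp [gradient, h.fderiv_eq_zero]

theorem sum_gradient_minimizer (hf : IsProblem f L μ) (hn : 0 < n)
    (hmin : ∀ x, objective f xstar ≤ objective f x) : ∑ i, gradient (f i) xstar = 0 := by
  have h := gradient_objective_minimizer hmin
  rw [hf.gradient_objective] at h
  exact (smul_eq_zero.1 h).resolve_left (by positivity)

/-- Averaged co-coercivity at the minimizer. -/
theorem avg_sq_gradient_sub_le (hf : IsProblem f L μ) (hn : 0 < n)
    (hmin : ∀ x, objective f xstar ≤ objective f x) (x : Vec d) :
    (1 / (n : ℝ)) * ∑ i, ‖gradient (f i) x - gradient (f i) xstar‖ ^ 2 ≤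
      2 * L * (objective f x - objective f xstar) := by
  have h : ∑ i, ‖gradient (f i) x - gradient (f i) xstar‖ ^ 2 ≤
      ∑ i, 2 * L * (f i x - f i xstar - ⟪gradient (f i) xstar, x - xstar⟫_ℝ) :=
    Finset.sum_le_sum fun i _ => (hf.convex i).sq_norm_gradient_sub_le (hf.differentiable i)
      hf.L_pos (hf.lipschitz_gradient i) x xstar
  rw [← Finset.mul_sum, Finset.sum_sub_distrib, Finset.sum_sub_distrib, ← sum_inner,
    hf.sum_gradient_minimizer hn hmin, inner_zero_left, sub_zero] at h
  have h2 := mul_le_mul_of_nonneg_left h (by positivity : 0 ≤ 1 / (n : ℝ))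
  refine h2.trans (le_of_eq ?_)
  simp only [objective]
  ring

theorem inner_gradient_ge (hf : IsProblem f L μ) {σ : ℝ} (hσ : σ ≤ μ) (x : Vec d) :
    objective f x - objective f xstar + σ / 2 * ‖x - xstar‖ ^ 2 ≤
      ⟪x - xstar, gradient (objective f) x⟫_ℝ := by
  have h := hf.strongly_convex.add_inner_gradient_le hf.differentiable_objective x xstar
  rw [← neg_sub x xstar, inner_neg_right, norm_neg, real_inner_comm] at h
  have h2 := mul_le_mul_of_nonneg_right hσ (sq_nonneg ‖x - xstar‖)
  linarith

end IsProblem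

/-! ### The update direction -/

theorem gradient_apply_of_notMem_supp {i : Fin n} {v : Fin d} (hv : v ∉ supp f i) (x : Vec d) :
    gradient (f i) x v = 0 := by
  by_contra h
  exact hv ⟨x, h⟩

theorem direction_apply_of_notMem_supp {i : Fin n} {v : Fin d} (hv : v ∉ supp f i) (x : Vec d)
    (α : Fin n → Vec d) : direction f x α i v = 0 := by
  simp [direction, hv]

theorem sparsity_nonneg : 0 ≤ sparsity f := by
  unfold sparsity; positivity

theorem featureProb_le_sparsity (v : Fin d) : featureProb f v ≤ sparsity f := by
  unfold featureProb sparsity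
  gcongr
  exact Finset.le_sup (f := fun v => featureDegree f v) (Finset.mem_univ v)

theorem sparsity_eq_zero_or (f : Fin n → Vec d → ℝ) :
    sparsity f = 0 ∨ 1 / (n : ℝ) ≤ sparsity f := by
  unfold sparsity
  rcases Nat.eq_zero_or_pos (Finset.univ.sup fun v : Fin d => featureDegree f v) with h | h
  · left; simp [h]
  · right; gcongr; exact_mod_cast h

theorem featureDegree_pos {i : Fin n} {v : Fin d} (hv : v ∈ supp f i) : 0 < featureDegree f v :=
  Finset.card_pos.2 ⟨i, by simpa using hv⟩

open scoped Classical in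
theorem sum_ite_mem_supp (v : Fin d) (c : ℝ) :
    ∑ i, (if v ∈ supp f i then c else 0) = featureDegree f v * c := by
  rw [← Finset.sum_filter, Finset.sum_const, nsmul_eq_mul, featureDegree]

/-- The update direction is unbiased: the weights `1 / p_v` compensate for the projection onto
`S_i`, and the two occurrences of the stored gradients cancel in the mean. -/
theorem sum_direction_apply (hn : 0 < n) (x : Vec d) {α : Fin n → Vec d}
    (hα : ∀ i v, v ∉ supp f i → α i v = 0) (v : Fin d) :
    ∑ i, direction f x α i v = ∑ i, gradient (f i) x v := by
  classical
  set m : ℝ := (1 / featureProb f v) * ((1 / (n : ℝ)) * ∑ k, α k v) with hm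
  have h1 : ∀ i, direction f x α i v =
      gradient (f i) x v - α i v + if v ∈ supp f i then m else 0 := by
    intro i
    by_cases hv : v ∈ supp f i
    · simp [direction, hv, hm]
    · simp [direction, hv, hα i v hv, gradient_apply_of_notMem_supp hv x]
  simp only [h1, Finset.sum_add_distrib, Finset.sum_sub_distrib, sum_ite_mem_supp]
  suffices h : (featureDegree f v : ℝ) * m = ∑ k, α k v by rw [h]; ring
  rcases Nat.eq_zero_or_pos (featureDegree f v) with h0 | h0
  · have : ∀ k, α k v = 0 := fun k => hα k v fun hv => (featureDegree_pos hv).ne' h0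
    simp [h0, this]
  · rw [hm, featureProb]
    field_simp

/-- Second moment of the update direction. The stored gradients are centred at the gradients at
the minimizer; the reweighted mean then only decreases the second moment, as in a variance. -/
theorem sum_sq_direction_le (hn : 0 < n) (x : Vec d) {α b : Fin n → Vec d}
    (hα : ∀ i v, v ∉ supp f i → α i v = 0) (hb : ∀ i v, v ∉ supp f i → b i v = 0)
    (hb0 : ∑ i, b i = 0) :
    ∑ i, ‖direction f x α i‖ ^ 2 ≤
      2 * ∑ i, ‖gradient (f i) x - b i‖ ^ 2 + 2 * ∑ i, ‖α i - b i‖ ^ 2 := by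
  classical
  simp only [EuclideanSpace.real_norm_sq_eq]
  simp only [Finset.sum_comm (s := (Finset.univ : Finset (Fin n)))]
  rw [Finset.mul_sum, Finset.mul_sum, ← Finset.sum_add_distrib]
  refine Finset.sum_le_sum fun v _ => ?_
  simp only [PiLp.sub_apply]
  set m : ℝ := (1 / featureProb f v) * ((1 / (n : ℝ)) * ∑ k, α k v) with hm
  have hsb : ∑ i, b i v = 0 := by
    have := congrArg (fun z : Vec d => z v) hb0
    simpa using this
  have h1 : ∀ i, direction f x α i v ^ 2 ≤ 2 * (gradient (f i) x v - b i v) ^ 2 +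
      2 * ((α i v - b i v) ^ 2 - 2 * m * (α i v - b i v) +
        if v ∈ supp f i then m ^ 2 else 0) := by
    intro i
    by_cases hv : v ∈ supp f i
    · have : direction f x α i v = gradient (f i) x v - α i v + m := by
        simp [direction, hv, hm]
      rw [this, if_pos hv]
      nlinarith [sq_nonneg (gradient (f i) x v - b i v + (α i v - b i v - m))]
    · simp [direction, hv, hα i v hv, hb i v hv, gradient_apply_of_notMem_supp hv x]
  have h2 : (featureDegree f v : ℝ) * m = ∑ k, α k v := by
    rcases Nat.eq_zero_or_pos (featureDegree f v) with h0 | h0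
    · have : ∀ k, α k v = 0 := fun k => hα k v fun hv => (featureDegree_pos hv).ne' h0
      simp [h0, this]
    · rw [hm, featureProb]
      field_simp
  refine (Finset.sum_le_sum fun i _ => h1 i).trans ?_
  simp only [Finset.sum_add_distrib, ← Finset.mul_sum, Finset.sum_sub_distrib, sum_ite_mem_supp,
    hsb]
  have h3 : (featureDegree f v : ℝ) * m ^ 2 = m * ∑ k, α k v := by rw [← h2]; ring
  have h4 : 0 ≤ (featureDegree f v : ℝ) * m ^ 2 := by positivity
  rw [h3] at h4 ⊢
  linarith

/-! ### Pathwise consequences of the overlap bound -/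

/-- The update direction used by iteration `t`. -/
noncomputable def stepDirection {n d : ℕ} (f : Fin n → Vec d → ℝ) (idx : ℕ → Fin n)
    (xhat : ℕ → Vec d) (αhat : ℕ → Fin n → Vec d) (t : ℕ) : Vec d :=
  direction f (xhat t) (αhat t) (idx t)

/-- The virtual (perturbed) iterate `x_t`: the initial point plus all the updates of the iterations
labelled before `t`, whether or not they have been written when iteration `t` reads. -/
noncomputable def virtualIterate {n d : ℕ} (f : Fin n → Vec d → ℝ) (γ : ℝ) (x₀ : Vec d)
    (idx : ℕ → Fin n) (xhat : ℕ → Vec d) (αhat : ℕ → Fin n → Vec d) (t : ℕ) : Vec d :=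
  x₀ - γ • ∑ u ∈ Finset.range t, stepDirection f idx xhat αhat u

/-- The indicator of the event that the index `j` is sampled by no iteration in `[a, b)`. -/
def avoids {n : ℕ} (idx : ℕ → Fin n) (j : Fin n) (a b : ℕ) : ℝ :=
  ∏ w ∈ Finset.Ico a b, if idx w = j then 0 else 1

theorem avoids_nonneg {n : ℕ} (idx : ℕ → Fin n) (j : Fin n) (a b : ℕ) : 0 ≤ avoids idx j a b :=
  Finset.prod_nonneg fun w _ => by split_ifs <;> norm_num

theorem avoids_eq_one {n : ℕ} {idx : ℕ → Fin n} {j : Fin n} {a b : ℕ}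
    (h : ∀ w ∈ Finset.Ico a b, idx w ≠ j) : avoids idx j a b = 1 :=
  Finset.prod_eq_one fun w hw => if_neg (h w hw)

namespace IsExecution

variable {n d : ℕ} {f : Fin n → Vec d → ℝ} {γ : ℝ} {x₀ : Vec d} {α₀ : Fin n → Vec d} {τ : ℕ}
  {s : Schedule n d} {idx : ℕ → Fin n} {xhat : ℕ → Vec d} {αhat : ℕ → Fin n → Vec d}

theorem αhat_apply_of_notMem_supp (h : IsExecution f γ x₀ α₀ s idx xhat αhat)
    (hα₀ : ∀ i v, v ∉ supp f i → α₀ i v = 0) (t : ℕ) (i : Fin n) (v : Fin d) (hv : v ∉ supp f i) :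
    αhat t i v = 0 := by
  rcases h.read_mem t i v with ⟨-, h1⟩ | ⟨u, ⟨-, h1, -⟩, -⟩
  · rw [h1, hα₀ i v hv]
  · exact absurd h1 hv

/-- A read and the virtual iterate differ only by updates of the `τ` preceding iterations. -/
theorem abs_xhat_sub_virtualIterate_le (h : IsExecution f γ x₀ α₀ s idx xhat αhat)
    (ha : s.AfterRead) (ho : s.OverlapBound τ) (hγ : 0 ≤ γ) (t : ℕ) (v : Fin d) :
    |xhat t v - virtualIterate f γ x₀ idx xhat αhat t v| ≤
      γ * ∑ u ∈ Finset.Ico (t - τ) t, |stepDirection f idx xhat αhat u v| := by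
  classical
  have h1 : xhat t v - virtualIterate f γ x₀ idx xhat αhat t v = γ * ∑ u ∈ Finset.range t,
      if s.writeX u v < s.readX t v then 0 else stepDirection f idx xhat αhat u v := by
    rw [h.read_x t v, virtualIterate, Finset.sum_filter]
    simp only [PiLp.sub_apply, PiLp.smul_apply, WithLp.ofLp_sum, Finset.sum_apply, smul_eq_mul]
    rw [sub_sub_sub_cancel_left, ← mul_sub, ← Finset.sum_sub_distrib]
    congr 1
    refine Finset.sum_congr rfl fun u _ => ?_
    by_cases hv : v ∈ supp f (idx u)
    · by_cases hw : s.writeX u v < s.readX t v <;> simp [hv, hw, stepDirection]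
    · simp [hv, stepDirection, direction_apply_of_notMem_supp]
  rw [h1, abs_mul, abs_of_nonneg hγ]
  refine mul_le_mul_of_nonneg_left ?_ hγ
  have h2 : Finset.Ico (t - τ) t ⊆ Finset.range t := fun u hu => by
    simp only [Finset.mem_Ico, Finset.mem_range] at *; exact hu.2
  rw [← Finset.sum_subset h2]
  · refine (Finset.abs_sum_le_sum_abs _ _).trans (Finset.sum_le_sum fun u _ => ?_)
    split_ifs
    · simp
    · exact le_rfl
  · intro u hu hu'
    simp only [Finset.mem_Ico, Finset.mem_range] at hu hu'
    have h3 := ho u t (by omega)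
    rw [if_pos]
    linarith [ha.writeX_le_finish u v, ha.start_le_readX t v]

theorem start_le_readDone (ha : s.AfterRead) (v : Fin d) (t : ℕ) : s.start t ≤ s.readDone t :=
  (ha.start_le_readX t v).trans (ha.readX_le t v)

theorem lt_of_writeMem_lt (ha : s.AfterRead) {u t : ℕ} {j : Fin n} {v : Fin d}
    (hu : s.writeMem u v < s.readMem t j v) : u < t := by
  by_contra hle
  have h1 := ha.labels (not_lt.1 hle)
  linarith [ha.lt_writeMem u v, ha.readMem_le t j v]

/-- A stored gradient read by iteration `t` comes either from an iteration `u` that sampled `j` and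
such that `j` was not sampled between `u + τ + 1` and `t - τ - 1`, or from the initial memory, and
then `j` was not sampled before `t - τ`. -/
theorem sq_norm_αhat_sub_le (h : IsExecution f γ x₀ α₀ s idx xhat αhat)
    (ha : s.AfterRead) (ho : s.OverlapBound τ) (hα₀ : ∀ i v, v ∉ supp f i → α₀ i v = 0)
    (t : ℕ) (j : Fin n) {b : Vec d} (hb : ∀ v, v ∉ supp f j → b v = 0) :
    ‖αhat t j - b‖ ^ 2 ≤
      (∑ u ∈ Finset.range t, avoids idx j (u + τ + 1) (t - τ) *
        if idx u = j then ‖gradient (f j) (xhat u) - b‖ ^ 2 else 0) +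
      avoids idx j 0 (t - τ) * ‖α₀ j - b‖ ^ 2 := by
  have hsq : ∀ (u : ℕ) (z : Vec d), (if idx u = j then ‖z‖ ^ 2 else 0) =
      ∑ v, if idx u = j then z v ^ 2 else 0 := by
    intro u z
    split_ifs <;> simp [EuclideanSpace.real_norm_sq_eq]
  simp only [hsq]
  simp only [EuclideanSpace.real_norm_sq_eq, Finset.mul_sum]
  rw [Finset.sum_comm, ← Finset.sum_add_distrib]
  refine Finset.sum_le_sum fun v _ => ?_
  simp only [PiLp.sub_apply]
  have hnn : ∀ u, 0 ≤ avoids idx j (u + τ + 1) (t - τ) *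
      if idx u = j then (gradient (f j) (xhat u) v - b v) ^ 2 else 0 := by
    intro u
    refine mul_nonneg (avoids_nonneg _ _ _ _) ?_
    split_ifs <;> positivity
  have hnn₀ : 0 ≤ avoids idx j 0 (t - τ) * (α₀ j v - b v) ^ 2 :=
    mul_nonneg (avoids_nonneg _ _ _ _) (sq_nonneg _)
  by_cases hv : v ∈ supp f j
  swap
  · rw [h.αhat_apply_of_notMem_supp hα₀ t j v hv, hb v hv, sub_zero, zero_pow two_ne_zero]
    rw [hb v hv] at hnn hnn₀
    exact add_nonneg (Finset.sum_nonneg fun u _ => hnn u) hnn₀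
  have hread : ∀ w < t - τ, s.writeMem w v < s.readMem t j v := fun w hw => by
    linarith [ho w t (by omega), ha.writeMem_le_finish w v, ha.start_le_readMem t j v]
  rcases h.read_mem t j v with ⟨h1, h2⟩ | ⟨u, ⟨hu1, -, hu2⟩, hu3, h2⟩
  · rw [h2, avoids_eq_one fun w hw hwj => h1 w ⟨hwj, hv, hread w (Finset.mem_Ico.1 hw).2⟩, one_mul]
    exact le_add_of_nonneg_left (Finset.sum_nonneg fun u _ => hnn u)
  · refine le_add_of_le_of_nonneg ?_ hnn₀
    rw [h2]
    refine le_trans (le_of_eq ?_) (Finset.single_le_sum (fun u _ => hnn u)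
      (Finset.mem_range.2 (lt_of_writeMem_lt ha hu2)))
    rw [if_pos hu1, avoids_eq_one, one_mul]
    intro w hw hwj
    -- such an iteration `w` would have overwritten the value stored by `u`
    rw [Finset.mem_Ico] at hw
    linarith [hu3 w hwj (hread w hw.2), ho u w hw.1, ha.writeMem_le_finish u v,
      start_le_readDone ha v w, ha.lt_writeMem w v]

end IsExecution

/-! ### Random variables determined by the past -/

theorem finite_range_of_factorsThrough {Ω α β : Type*} {X : Ω → β} {H : Ω → α}
    (hX : X.FactorsThrough H) (hH : (Set.range H).Finite) : (Set.range X).Finite := by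
  rcases isEmpty_or_nonempty Ω with hΩ | ⟨⟨ω₀⟩⟩
  · simp [Set.range_eq_empty]
  have : Nonempty β := ⟨X ω₀⟩
  obtain ⟨g, hg⟩ := (Function.factorsThrough_iff X).1 hX
  rw [hg, Set.range_comp]
  exact hH.image g

theorem finite_range_pi {Ω ι : Type*} {β : ι → Type*} [Finite ι] {X : Ω → ∀ i, β i}
    (hX : ∀ i, (Set.range fun ω => X ω i).Finite) : (Set.range X).Finite := by
  refine (Set.Finite.pi hX).subset ?_
  rintro _ ⟨ω, rfl⟩ i -
  exact ⟨ω, rfl⟩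

theorem finite_range_prodMk {Ω α β : Type*} {X : Ω → α} {Y : Ω → β} (hX : (Set.range X).Finite)
    (hY : (Set.range Y).Finite) : (Set.range fun ω => (X ω, Y ω)).Finite := by
  refine (hX.prod hY).subset ?_
  rintro _ ⟨ω, rfl⟩
  exact ⟨⟨ω, rfl⟩, ⟨ω, rfl⟩⟩

theorem finite_range_vec {Ω : Type*} {d : ℕ} {X : Ω → Vec d}
    (hX : ∀ v, (Set.range fun ω => X ω v).Finite) : (Set.range X).Finite := by
  have h := (finite_range_pi (X := fun ω v => X ω v) hX).image (WithLp.toLp 2)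
  refine h.subset ?_
  rintro _ ⟨ω, rfl⟩
  exact ⟨_, ⟨ω, rfl⟩, rfl⟩

/-- A real function of a finitely-valued random variable is a measurable function of it. -/
theorem exists_measurable_comp_eq {Ω α : Type*} [MeasurableSpace α]
    [MeasurableSingletonClass α] {X : Ω → ℝ} {H : Ω → α} (hX : X.FactorsThrough H)
    (hH : (Set.range H).Finite) : ∃ φ : α → ℝ, Measurable φ ∧ X = φ ∘ H := by
  obtain ⟨g, hg⟩ := (Function.factorsThrough_iff X).1 hX
  refine ⟨(Set.range H).indicator g, ?_, ?_⟩
  · refine measurable_of_measurable_on_compl_finite _ hH ?_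
    have : (Set.range H)ᶜ.domRestrict ((Set.range H).indicator g) = fun _ => 0 := by
      funext x
      exact Set.indicator_of_notMem x.2 g
    rw [this]
    exact measurable_const
  · funext ω
    simp [hg]

section History

variable {n d : ℕ} {Ω : Type*} {idx : ℕ → Ω → Fin n} {xhat : ℕ → Ω → Vec d}
  {αhat : ℕ → Ω → Fin n → Vec d}

theorem history_eq_iff {t : ℕ} {ω ω' : Ω} :
    history idx xhat αhat t ω = history idx xhat αhat t ω' ↔
      (∀ s ≤ t, xhat s ω = xhat s ω' ∧ αhat s ω = αhat s ω') ∧ ∀ s < t, idx s ω = idx s ω' := by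
  simp only [history, Prod.mk.injEq, funext_iff (α := Fin (t + 1)), funext_iff (α := Fin t)]
  refine and_congr ⟨fun h s hs => h ⟨s, Nat.lt_succ_of_le hs⟩, fun h s => h s (by omega)⟩
    ⟨fun h s hs => h ⟨s, hs⟩, fun h s => h s s.2⟩

/-- `X` is a function of the past of iteration `t`. -/
def Past {β : Type*} (idx : ℕ → Ω → Fin n) (xhat : ℕ → Ω → Vec d)
    (αhat : ℕ → Ω → Fin n → Vec d) (t : ℕ) (X : Ω → β) : Prop :=
  X.FactorsThrough (history idx xhat αhat t)

theorem Past.mono {β : Type*} {X : Ω → β} {s t : ℕ} (hX : Past idx xhat αhat s X) (hst : s ≤ t) :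
    Past idx xhat αhat t X := by
  intro ω ω' h
  rw [history_eq_iff] at h
  exact hX (history_eq_iff.2
    ⟨fun r hr => h.1 r (hr.trans hst), fun r hr => h.2 r (hr.trans_le hst)⟩)

theorem past_xhat {s t : ℕ} (hst : s ≤ t) : Past idx xhat αhat t (xhat s) :=
  fun _ _ h => ((history_eq_iff.1 h).1 s hst).1

theorem past_αhat {s t : ℕ} (hst : s ≤ t) : Past idx xhat αhat t (αhat s) :=
  fun _ _ h => ((history_eq_iff.1 h).1 s hst).2

theorem past_idx {s t : ℕ} (hst : s < t) : Past idx xhat αhat t (idx s) :=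
  fun _ _ h => (history_eq_iff.1 h).2 s hst

theorem past_const {β : Type*} {t : ℕ} (c : β) : Past idx xhat αhat t (fun _ => c) :=
  fun _ _ _ => rfl

theorem Past.comp {β β' : Type*} {t : ℕ} {X : Ω → β} (hX : Past idx xhat αhat t X) (φ : β → β') :
    Past idx xhat αhat t (fun ω => φ (X ω)) :=
  fun _ _ h => congrArg φ (hX h)

theorem Past.comp₂ {β β' β'' : Type*} {t : ℕ} {X : Ω → β} {Y : Ω → β'}
    (hX : Past idx xhat αhat t X) (hY : Past idx xhat αhat t Y) (φ : β → β' → β'') :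
    Past idx xhat αhat t (fun ω => φ (X ω) (Y ω)) :=
  fun _ _ h => congrArg₂ φ (hX h) (hY h)

theorem past_stepDirection (f : Fin n → Vec d → ℝ) {s t : ℕ} (hst : s < t) :
    Past idx xhat αhat t (fun ω => stepDirection f (fun r => idx r ω) (fun r => xhat r ω)
      (fun r => αhat r ω) s) :=
  ((past_xhat hst.le).comp₂ ((past_αhat hst.le).comp₂ (past_idx hst) Prod.mk)
    fun x p => direction f x p.1 p.2)

theorem past_virtualIterate (f : Fin n → Vec d → ℝ) (γ : ℝ) (x₀ : Vec d) (t : ℕ) :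
    Past idx xhat αhat t (fun ω => virtualIterate f γ x₀ (fun r => idx r ω) (fun r => xhat r ω)
      (fun r => αhat r ω) t) := by
  intro ω ω' h
  simp only [virtualIterate]
  rw [Finset.sum_congr rfl fun u hu => past_stepDirection f (Finset.mem_range.1 hu) h]

theorem past_avoids (j : Fin n) (a : ℕ) {b t : ℕ} (hbt : b ≤ t) :
    Past idx xhat αhat t (fun ω => avoids (fun r => idx r ω) j a b) := by
  intro ω ω' h
  refine Finset.prod_congr rfl fun w hw => ?_
  beta_reduce
  rw [past_idx ((Finset.mem_Ico.1 hw).2.trans_le hbt) h]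

end History

namespace IsRun

variable {n d : ℕ} {f : Fin n → Vec d → ℝ} {γ : ℝ} {x₀ : Vec d} {α₀ : Fin n → Vec d}
  {τ : ℕ} {Ω : Type*} [MeasurableSpace Ω] {P : Measure Ω} {sched : Ω → Schedule n d}
  {idx : ℕ → Ω → Fin n} {xhat : ℕ → Ω → Vec d} {αhat : ℕ → Ω → Fin n → Vec d}

theorem finite_range_read (h : IsRun f γ x₀ α₀ τ P sched idx xhat αhat) (t : ℕ) :
    (Set.range fun ω => (xhat t ω, αhat t ω)).Finite := by
  classical
  induction t using Nat.strong_induction_on with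
  | _ t ih =>
    -- everything read and sampled before iteration `t`
    let Y : Ω → Fin t → (Vec d × (Fin n → Vec d)) × Fin n :=
      fun ω u => ((xhat u ω, αhat u ω), idx u ω)
    have hY : (Set.range Y).Finite :=
      finite_range_pi fun u => finite_range_prodMk (ih u u.2) (Set.toFinite _)
    have hYu : ∀ {u : ℕ}, u < t → ∀ {ω ω'}, Y ω = Y ω' →
        xhat u ω = xhat u ω' ∧ αhat u ω = αhat u ω' ∧ idx u ω = idx u ω' := by
      intro u hu ω ω' he
      have := congrFun he ⟨u, hu⟩
      simpa [Y, and_assoc] using this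
    refine finite_range_prodMk (finite_range_vec fun v => ?_)
      (finite_range_pi fun j => finite_range_vec fun v => ?_)
    · refine (Set.Finite.biUnion (Finset.range t).powerset.finite_toSet
        (t := fun A => Set.range fun ω => x₀ v - γ * ∑ u ∈ A,
          direction f (xhat u ω) (αhat u ω) (idx u ω) v) fun A hA => ?_).subset ?_
      · refine finite_range_of_factorsThrough (fun ω ω' he => ?_) hY
        have hA' := Finset.mem_powerset.1 hA
        have : ∀ u ∈ A, direction f (xhat u ω) (αhat u ω) (idx u ω) v =
            direction f (xhat u ω') (αhat u ω') (idx u ω') v := by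
          intro u hu
          obtain ⟨h1, h2, h3⟩ := hYu (Finset.mem_range.1 (hA' hu)) he
          rw [h1, h2, h3]
        simp only [Finset.sum_congr rfl this]
      · rintro _ ⟨ω, rfl⟩
        refine Set.mem_biUnion (Finset.mem_coe.2 (Finset.mem_powerset.2
          (Finset.filter_subset _ _))) ⟨ω, ((h.execution ω).read_x t v).symm⟩
    · refine ((Set.finite_singleton (α₀ j v)).union (Set.Finite.biUnion
        (Finset.range t).finite_toSet (t := fun u => Set.range fun ω =>
          gradient (f j) (xhat u ω) v) fun u hu => ?_)).subset ?_
      · refine finite_range_of_factorsThrough (fun ω ω' he => ?_) hY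
        simp only [(hYu (Finset.mem_range.1 hu) he).1]
      · rintro _ ⟨ω, rfl⟩
        rcases (h.execution ω).read_mem t j v with ⟨-, h1⟩ | ⟨u, ⟨-, -, h1⟩, -, h2⟩
        · exact Or.inl h1
        · exact Or.inr (Set.mem_biUnion (Finset.mem_coe.2 (Finset.mem_range.2
            (IsExecution.lt_of_writeMem_lt (h.after_read ω) h1))) ⟨ω, h2.symm⟩)

theorem finite_range_history (h : IsRun f γ x₀ α₀ τ P sched idx xhat αhat) (t : ℕ) :
    (Set.range (history idx xhat αhat t)).Finite :=
  finite_range_prodMk (finite_range_pi fun s => h.finite_range_read s) (Set.toFinite _)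

theorem measurable_history (h : IsRun f γ x₀ α₀ τ P sched idx xhat αhat) (t : ℕ) :
    Measurable (history idx xhat αhat t) := by
  unfold history
  refine Measurable.prodMk (measurable_pi_lambda _ fun s => ?_) (measurable_pi_lambda _ fun s => ?_)
  · exact (h.measurable_xhat s).prodMk (h.measurable_αhat s)
  · exact h.measurable_idx s

/-- Every iterate takes finitely many values, so there are no integrability conditions. -/
theorem integrable_of_past [IsProbabilityMeasure P]
    (h : IsRun f γ x₀ α₀ τ P sched idx xhat αhat) {t : ℕ} {X : Ω → ℝ}
    (hX : Past idx xhat αhat t X) : Integrable X P := by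
  obtain ⟨φ, hφ, rfl⟩ := exists_measurable_comp_eq hX (h.finite_range_history t)
  obtain ⟨C, hC⟩ := (finite_range_of_factorsThrough hX (h.finite_range_history t)).isBounded
    |>.exists_norm_le
  exact Integrable.of_bound (hφ.comp (h.measurable_history t)).aestronglyMeasurable C
    (Filter.Eventually.of_forall fun ω => hC _ ⟨ω, rfl⟩)

/-- Averaging over the index of iteration `t` conditionally on its past. -/
theorem integral_comp_idx [IsProbabilityMeasure P]
    (h : IsRun f γ x₀ α₀ τ P sched idx xhat αhat) {t : ℕ} {X : Ω → Fin n → ℝ}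
    (hX : ∀ i, Past idx xhat αhat t (fun ω => X ω i)) :
    ∫ ω, X ω (idx t ω) ∂P = (1 / (n : ℝ)) * ∑ i, ∫ ω, X ω i ∂P := by
  classical
  have h1 : ∀ ω, X ω (idx t ω) = ∑ i, X ω i * (if idx t ω = i then 1 else 0) := by
    intro ω; simp
  have hpi : ∀ i, Past idx xhat αhat (t + 1) (fun ω => X ω i * (if idx t ω = i then 1 else 0)) :=
    fun i => ((hX i).mono t.le_succ).comp₂ (past_idx t.lt_succ_self)
      fun x k => x * (if k = i then 1 else 0)
  simp only [h1]
  rw [integral_finsetSum _ fun i _ => h.integrable_of_past (hpi i), Finset.mul_sum]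
  refine Finset.sum_congr rfl fun i _ => ?_
  obtain ⟨φ, hφ, hφX⟩ := exists_measurable_comp_eq (hX i) (h.finite_range_history t)
  have hψ : Measurable fun k : Fin n => if k = i then (1 : ℝ) else 0 := measurable_of_finite _
  have hind := (h.indep t).comp hφ hψ
  rw [← hφX] at hind
  have h2 := hind.integral_fun_mul_eq_mul_integral
    (h.integrable_of_past (hX i)).aestronglyMeasurable
    (hψ.comp (h.measurable_idx t)).aestronglyMeasurable
  have h3 : ∫ ω, ((fun k : Fin n => if k = i then (1 : ℝ) else 0) ∘ idx t) ω ∂P = 1 / n := by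
    have h4 : ((fun k : Fin n => if k = i then (1 : ℝ) else 0) ∘ idx t) =
        (idx t ⁻¹' {i}).indicator 1 := by
      funext ω
      simp [Set.indicator_apply]
    rw [h4, integral_indicator_one (h.measurable_idx t (MeasurableSet.singleton i)), Measure.real,
      h.uniform t i]
    simp
  rw [h3] at h2
  rw [mul_comm (1 / (n : ℝ))]
  exact h2

/-- A given index is avoided during `b - a` iterations with probability `(1 - 1/n)^(b - a)`,
independently of the past of the first of them. -/
theorem integral_avoids_mul [IsProbabilityMeasure P]
    (h : IsRun f γ x₀ α₀ τ P sched idx xhat αhat) (j : Fin n) {a : ℕ} {X : Ω → ℝ}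
    (hX : Past idx xhat αhat a X) (b : ℕ) :
    ∫ ω, avoids (fun t => idx t ω) j a b * X ω ∂P =
      (1 - 1 / (n : ℝ)) ^ (b - a) * ∫ ω, X ω ∂P := by
  rcases le_total b a with hba | hab
  · simp [avoids, Finset.Ico_eq_empty_of_le hba, Nat.sub_eq_zero_of_le hba]
  obtain ⟨m, rfl⟩ := Nat.exists_eq_add_of_le hab
  clear hab
  rw [Nat.add_sub_cancel_left]
  induction m with
  | zero => simp [avoids]
  | succ m ih =>
    have hn : (n : ℝ) ≠ 0 := by exact_mod_cast j.pos.ne'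
    set Z : Ω → ℝ := fun ω => avoids (fun t => idx t ω) j a (a + m) * X ω with hZdef
    have hZ : Past idx xhat αhat (a + m) Z :=
      (past_avoids j a le_rfl).comp₂ (hX.mono (Nat.le_add_right a m)) (· * ·)
    have h3 : ∀ ω, avoids (fun t => idx t ω) j a (a + (m + 1)) * X ω =
        if idx (a + m) ω = j then 0 else Z ω := by
      intro ω
      simp only [avoids, hZdef]
      rw [← add_assoc, Finset.prod_Ico_succ_top (Nat.le_add_right a m)]
      split_ifs <;> simp
    simp only [h3]
    rw [h.integral_comp_idx (X := fun ω i => if i = j then 0 else Z ω) fun i =>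
      hZ.comp fun z => if i = j then 0 else z]
    have h6 : ∀ i, ∫ ω, (if i = j then 0 else Z ω) ∂P =
        ∫ ω, Z ω ∂P - if i = j then ∫ ω, Z ω ∂P else 0 := by
      intro i
      split_ifs <;> simp
    simp only [h6, Finset.sum_sub_distrib, Finset.sum_ite_eq', Finset.mem_univ, if_true,
      Finset.sum_const, Finset.card_univ, Fintype.card_fin, nsmul_eq_mul]
    rw [ih, pow_succ]
    field_simp

end IsRun

/-! ### Expected errors of a run -/

section Errors

variable {n d : ℕ} {Ω : Type*} [MeasurableSpace Ω]

/-- The random update direction of iteration `t`. -/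
noncomputable def step (f : Fin n → Vec d → ℝ) (idx : ℕ → Ω → Fin n) (xhat : ℕ → Ω → Vec d)
    (αhat : ℕ → Ω → Fin n → Vec d) (t : ℕ) (ω : Ω) : Vec d :=
  stepDirection f (fun r => idx r ω) (fun r => xhat r ω) (fun r => αhat r ω) t

/-- The random virtual iterate `x_t`. -/
noncomputable def iterate (f : Fin n → Vec d → ℝ) (γ : ℝ) (x₀ : Vec d) (idx : ℕ → Ω → Fin n)
    (xhat : ℕ → Ω → Vec d) (αhat : ℕ → Ω → Fin n → Vec d) (t : ℕ) (ω : Ω) : Vec d :=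
  virtualIterate f γ x₀ (fun r => idx r ω) (fun r => xhat r ω) (fun r => αhat r ω) t

/-- The second moment of the update direction of iteration `t`. -/
noncomputable def stepMoment (P : Measure Ω) (f : Fin n → Vec d → ℝ) (idx : ℕ → Ω → Fin n)
    (xhat : ℕ → Ω → Vec d) (αhat : ℕ → Ω → Fin n → Vec d) (t : ℕ) : ℝ :=
  ∫ ω, ‖step f idx xhat αhat t ω‖ ^ 2 ∂P

/-- The expected suboptimality of the read of iteration `t`. -/
noncomputable def excess (P : Measure Ω) (f : Fin n → Vec d → ℝ) (xstar : Vec d)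
    (xhat : ℕ → Ω → Vec d) (t : ℕ) : ℝ :=
  ∫ ω, (objective f (xhat t ω) - objective f xstar) ∂P

/-- The mean squared distance of the stored gradients read by iteration `t` from the gradients at
the minimizer. -/
noncomputable def memError (P : Measure Ω) (f : Fin n → Vec d → ℝ) (xstar : Vec d)
    (αhat : ℕ → Ω → Fin n → Vec d) (t : ℕ) : ℝ :=
  (1 / (n : ℝ)) * ∑ j, ∫ ω, ‖αhat t ω j - gradient (f j) xstar‖ ^ 2 ∂P

end Errors

theorem step_apply_of_notMem_supp {n d : ℕ} {Ω : Type*} {f : Fin n → Vec d → ℝ}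
    {idx : ℕ → Ω → Fin n} {xhat : ℕ → Ω → Vec d} {αhat : ℕ → Ω → Fin n → Vec d} {t : ℕ} {ω : Ω}
    {v : Fin d} (hv : v ∉ supp f (idx t ω)) : step f idx xhat αhat t ω v = 0 :=
  direction_apply_of_notMem_supp hv _ _

theorem past_step {n d : ℕ} {Ω : Type*} {idx : ℕ → Ω → Fin n} {xhat : ℕ → Ω → Vec d}
    {αhat : ℕ → Ω → Fin n → Vec d} (f : Fin n → Vec d → ℝ) {s t : ℕ} (hst : s < t) :
    Past idx xhat αhat t (step f idx xhat αhat s) :=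
  past_stepDirection f hst

namespace IsRun

variable {n d : ℕ} {f : Fin n → Vec d → ℝ} {L μ γ : ℝ} {xstar x₀ : Vec d} {α₀ : Fin n → Vec d}
  {τ : ℕ} {Ω : Type*} [MeasurableSpace Ω] {P : Measure Ω} {sched : Ω → Schedule n d}
  {idx : ℕ → Ω → Fin n} {xhat : ℕ → Ω → Vec d} {αhat : ℕ → Ω → Fin n → Vec d}

theorem stepMoment_nonneg (t : ℕ) : 0 ≤ stepMoment P f idx xhat αhat t :=
  integral_nonneg fun _ => sq_nonneg _

theorem excess_nonneg (hmin : ∀ x, objective f xstar ≤ objective f x) (t : ℕ) :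
    0 ≤ excess P f xstar xhat t :=
  integral_nonneg fun _ => sub_nonneg.2 (hmin _)

variable [IsProbabilityMeasure P]

theorem stepMoment_le (h : IsRun f γ x₀ α₀ τ P sched idx xhat αhat) (hf : IsProblem f L μ)
    (hn : 0 < n) (hmin : ∀ x, objective f xstar ≤ objective f x)
    (hα₀ : ∀ i v, v ∉ supp f i → α₀ i v = 0) (t : ℕ) :
    stepMoment P f idx xhat αhat t ≤
      4 * L * excess P f xstar xhat t + 2 * memError P f xstar αhat t := by
  have hx : Past idx xhat αhat t (xhat t) := past_xhat le_rfl
  have hα : Past idx xhat αhat t (αhat t) := past_αhat le_rfl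
  have h1 : stepMoment P f idx xhat αhat t =
      (1 / (n : ℝ)) * ∑ i, ∫ ω, ‖direction f (xhat t ω) (αhat t ω) i‖ ^ 2 ∂P :=
    h.integral_comp_idx (X := fun ω i => ‖direction f (xhat t ω) (αhat t ω) i‖ ^ 2) fun i =>
      hx.comp₂ hα fun x α => ‖direction f x α i‖ ^ 2
  have hint : ∀ i, Integrable (fun ω => ‖direction f (xhat t ω) (αhat t ω) i‖ ^ 2) P := fun i =>
    h.integrable_of_past (hx.comp₂ hα fun x α => ‖direction f x α i‖ ^ 2)
  have hintα : ∀ j, Integrable (fun ω => ‖αhat t ω j - gradient (f j) xstar‖ ^ 2) P := fun j =>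
    h.integrable_of_past (hα.comp fun α => ‖α j - gradient (f j) xstar‖ ^ 2)
  have hinte : Integrable (fun ω => objective f (xhat t ω) - objective f xstar) P :=
    h.integrable_of_past (hx.comp fun x => objective f x - objective f xstar)
  rw [h1, ← integral_finsetSum _ fun i _ => hint i, excess, memError,
    ← integral_finsetSum _ fun i _ => hintα i, ← integral_const_mul, ← integral_const_mul,
    ← integral_const_mul, ← integral_const_mul, ← integral_add (hinte.const_mul _)
      (((integrable_finsetSum _ fun i _ => hintα i).const_mul _).const_mul _)]
  refine integral_mono ((integrable_finsetSum _ fun i _ => hint i).const_mul _)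
    ((hinte.const_mul _).add
      (((integrable_finsetSum _ fun i _ => hintα i).const_mul _).const_mul _)) fun ω => ?_
  have h2 := sum_sq_direction_le hn (xhat t ω)
    (fun i v hv => (h.execution ω).αhat_apply_of_notMem_supp hα₀ t i v hv)
    (fun i v hv => gradient_apply_of_notMem_supp hv xstar) (hf.sum_gradient_minimizer hn hmin)
  have h3 := hf.avg_sq_gradient_sub_le hn hmin (xhat t ω)
  have h4 := mul_le_mul_of_nonneg_left h2 (by positivity : 0 ≤ 1 / (n : ℝ))
  simp only
  linarith

/-- The stored gradients are refreshed at rate `1/n`, with a delay due to the overlaps. The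
exponents are truncated subtractions: recently stored gradients are not discounted. -/
theorem memError_le (h : IsRun f γ x₀ α₀ τ P sched idx xhat αhat) (hf : IsProblem f L μ)
    (hn : 0 < n) (hmin : ∀ x, objective f xstar ≤ objective f x)
    (hα₀ : ∀ i v, v ∉ supp f i → α₀ i v = 0) (t : ℕ) :
    memError P f xstar αhat t ≤
      2 * L / n * ∑ u ∈ Finset.range t,
        (1 - 1 / (n : ℝ)) ^ (t - (u + 1 + 2 * τ)) * excess P f xstar xhat u +
      1 / n * ((1 - 1 / (n : ℝ)) ^ (t - τ) * ∑ j, ‖α₀ j - gradient (f j) xstar‖ ^ 2) := by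
  have hn1 : (0 : ℝ) ≤ 1 - 1 / n := by
    rw [sub_nonneg, div_le_one (by positivity)]
    exact_mod_cast hn
  have hD : ∀ u j, Past idx xhat αhat u
      (fun ω => ‖gradient (f j) (xhat u ω) - gradient (f j) xstar‖ ^ 2) := fun u j =>
    (past_xhat le_rfl).comp fun x => ‖gradient (f j) x - gradient (f j) xstar‖ ^ 2
  have hD' : ∀ u j, Past idx xhat αhat (u + 1) (fun ω => if idx u ω = j then
      ‖gradient (f j) (xhat u ω) - gradient (f j) xstar‖ ^ 2 else 0) := fun u j =>
    ((hD u j).mono u.le_succ).comp₂ (past_idx u.lt_succ_self) fun x k => if k = j then x else 0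
  have hint1 : ∀ j, ∀ u ∈ Finset.range t, Integrable (fun ω =>
      avoids (fun r => idx r ω) j (u + τ + 1) (t - τ) * if idx u ω = j then
        ‖gradient (f j) (xhat u ω) - gradient (f j) xstar‖ ^ 2 else 0) P := fun j u hu =>
    h.integrable_of_past (t := t) ((past_avoids j _ (Nat.sub_le t τ)).comp₂
      ((hD' u j).mono (Finset.mem_range.1 hu)) (· * ·))
  have hint2 : ∀ j, Integrable (fun ω =>
      avoids (fun r => idx r ω) j 0 (t - τ) * ‖α₀ j - gradient (f j) xstar‖ ^ 2) P := fun j =>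
    h.integrable_of_past (t := t) ((past_avoids j _ (Nat.sub_le t τ)).comp
      fun z => z * ‖α₀ j - gradient (f j) xstar‖ ^ 2)
  have h1 : ∀ j, ∫ ω, ‖αhat t ω j - gradient (f j) xstar‖ ^ 2 ∂P ≤
      (∑ u ∈ Finset.range t, (1 - 1 / (n : ℝ)) ^ (t - (u + 1 + 2 * τ)) * (1 / n *
        ∫ ω, ‖gradient (f j) (xhat u ω) - gradient (f j) xstar‖ ^ 2 ∂P)) +
      (1 - 1 / (n : ℝ)) ^ (t - τ) * ‖α₀ j - gradient (f j) xstar‖ ^ 2 := by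
    intro j
    have h2 := integral_mono (μ := P) (h.integrable_of_past ((past_αhat le_rfl).comp fun α =>
        ‖α j - gradient (f j) xstar‖ ^ 2))
      ((integrable_finsetSum _ (hint1 j)).add (hint2 j)) fun ω =>
        (h.execution ω).sq_norm_αhat_sub_le (h.after_read ω) (h.overlap ω) hα₀ t j
          fun v hv => gradient_apply_of_notMem_supp hv xstar
    refine h2.trans (le_of_eq ?_)
    simp only [Pi.add_apply]
    rw [integral_add (integrable_finsetSum _ (hint1 j)) (hint2 j),
      integral_finsetSum _ (hint1 j)]
    congr 1
    · refine Finset.sum_congr rfl fun u _ => ?_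
      rw [h.integral_avoids_mul j ((hD' u j).mono (by omega)),
        h.integral_comp_idx (X := fun ω i => if i = j then
          ‖gradient (f j) (xhat u ω) - gradient (f j) xstar‖ ^ 2 else 0) fun i =>
          (hD u j).comp fun x => if i = j then x else 0]
      have h3 : ∀ i, ∫ ω, (if i = j then
          ‖gradient (f j) (xhat u ω) - gradient (f j) xstar‖ ^ 2 else 0) ∂P = if i = j then
          ∫ ω, ‖gradient (f j) (xhat u ω) - gradient (f j) xstar‖ ^ 2 ∂P else 0 := by
        intro i
        split_ifs <;> simp
      simp only [h3, Finset.sum_ite_eq', Finset.mem_univ, if_true]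
      congr 2
      omega
    · have h3 := h.integral_avoids_mul j (a := 0)
        (past_const (‖α₀ j - gradient (f j) xstar‖ ^ 2)) (t - τ)
      rw [h3, integral_const]
      simp
  have h4 : ∀ u, (1 / (n : ℝ)) *
      ∑ j, ∫ ω, ‖gradient (f j) (xhat u ω) - gradient (f j) xstar‖ ^ 2 ∂P ≤
      2 * L * excess P f xstar xhat u := by
    intro u
    have hi : ∀ j, Integrable
        (fun ω => ‖gradient (f j) (xhat u ω) - gradient (f j) xstar‖ ^ 2) P :=
      fun j => h.integrable_of_past (hD u j)
    rw [← integral_finsetSum _ fun j _ => hi j, ← integral_const_mul, excess,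
      ← integral_const_mul]
    exact integral_mono ((integrable_finsetSum _ fun j _ => hi j).const_mul _)
      ((h.integrable_of_past ((past_xhat (t := u) le_rfl).comp
        fun x => objective f x - objective f xstar)).const_mul _)
      fun ω => hf.avg_sq_gradient_sub_le hn hmin (xhat u ω)
  rw [memError]
  refine (mul_le_mul_of_nonneg_left (Finset.sum_le_sum fun j _ => h1 j) (by positivity)).trans ?_
  rw [Finset.sum_add_distrib, mul_add, ← Finset.mul_sum]
  refine add_le_add ?_ le_rfl
  rw [Finset.sum_comm, Finset.mul_sum, Finset.mul_sum]
  refine Finset.sum_le_sum fun u _ => ?_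
  rw [← Finset.mul_sum, ← Finset.mul_sum]
  have h5 := mul_le_mul_of_nonneg_left (h4 u) (by positivity :
    0 ≤ 1 / (n : ℝ) * (1 - 1 / (n : ℝ)) ^ (t - (u + 1 + 2 * τ)))
  refine (le_of_eq ?_).trans (h5.trans (le_of_eq ?_)) <;> ring

/-! ### The effect of sparsity -/

/-- Updates of different iterations are nearly orthogonal when the gradients are sparse: a later
iteration touches a given coordinate with probability at most `Δ`. -/
theorem integral_sum_abs_mul_abs_le (h : IsRun f γ x₀ α₀ τ P sched idx xhat αhat) {u t : ℕ}
    (hut : u < t) :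
    ∫ ω, ∑ v, |step f idx xhat αhat u ω v| * |step f idx xhat αhat t ω v| ∂P ≤
      √(sparsity f) / 2 * (stepMoment P f idx xhat αhat u + stepMoment P f idx xhat αhat t) := by
  classical
  set Δ := sparsity f with hΔ
  have hΔ0 : 0 ≤ Δ := sparsity_nonneg
  have hgu : Past idx xhat αhat (t + 1) (step f idx xhat αhat u) := past_step f (by omega)
  have hgt : Past idx xhat αhat (t + 1) (step f idx xhat αhat t) := past_step f t.lt_succ_self
  have hintu : Integrable (fun ω => ‖step f idx xhat αhat u ω‖ ^ 2) P :=
    h.integrable_of_past (hgu.comp fun x => ‖x‖ ^ 2)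
  have hintt : Integrable (fun ω => ‖step f idx xhat αhat t ω‖ ^ 2) P :=
    h.integrable_of_past (hgt.comp fun x => ‖x‖ ^ 2)
  have hint : Integrable (fun ω => ∑ v,
      |step f idx xhat αhat u ω v| * |step f idx xhat αhat t ω v|) P :=
    h.integrable_of_past (hgu.comp₂ hgt fun x y => ∑ v, |x v| * |y v|)
  -- the part of the update `u` in the coordinates that iteration `t` updates
  let M : Ω → Fin n → ℝ := fun ω i =>
    ∑ v, if v ∈ supp f i then step f idx xhat αhat u ω v ^ 2 else 0
  have hM : ∀ i, Past idx xhat αhat t (fun ω => M ω i) := fun i =>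
    (past_step f hut).comp fun x => ∑ v, if v ∈ supp f i then x v ^ 2 else 0
  have hMint : Integrable (fun ω => M ω (idx t ω)) P :=
    h.integrable_of_past (((past_step f (hut.trans t.lt_succ_self))).comp₂
      (past_idx t.lt_succ_self) fun x i => ∑ v, if v ∈ supp f i then x v ^ 2 else 0)
  have hMle : ∫ ω, M ω (idx t ω) ∂P ≤ Δ * stepMoment P f idx xhat αhat u := by
    rw [h.integral_comp_idx hM, ← integral_finsetSum _ fun i _ => h.integrable_of_past (hM i),
      ← integral_const_mul, stepMoment, ← integral_const_mul]
    refine integral_mono ((integrable_finsetSum _ fun i _ =>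
      h.integrable_of_past (hM i)).const_mul _) (hintu.const_mul _) fun ω => ?_
    simp only [M]
    rw [Finset.sum_comm, EuclideanSpace.real_norm_sq_eq, Finset.mul_sum, Finset.mul_sum]
    refine Finset.sum_le_sum fun v _ => ?_
    rw [sum_ite_mem_supp, ← mul_assoc, one_div_mul_eq_div]
    exact mul_le_mul_of_nonneg_right (featureProb_le_sparsity v) (sq_nonneg _)
  have hpt : ∀ ω, √Δ * ∑ v, |step f idx xhat αhat u ω v| * |step f idx xhat αhat t ω v| ≤
      1 / 2 * M ω (idx t ω) + Δ / 2 * ‖step f idx xhat αhat t ω‖ ^ 2 := by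
    intro ω
    simp only [M]
    rw [EuclideanSpace.real_norm_sq_eq, Finset.mul_sum, Finset.mul_sum, Finset.mul_sum,
      ← Finset.sum_add_distrib]
    refine Finset.sum_le_sum fun v _ => ?_
    by_cases hv : v ∈ supp f (idx t ω)
    · rw [if_pos hv, ← sq_abs (step f idx xhat αhat u ω v), ← sq_abs (step f idx xhat αhat t ω v)]
      have := Real.sq_sqrt hΔ0
      nlinarith [sq_nonneg (|step f idx xhat αhat u ω v| - √Δ * |step f idx xhat αhat t ω v|)]
    · simp [hv, step_apply_of_notMem_supp hv]
  have h1 : √Δ * ∫ ω, ∑ v, |step f idx xhat αhat u ω v| * |step f idx xhat αhat t ω v| ∂P ≤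
      √Δ * (√Δ / 2 *
        (stepMoment P f idx xhat αhat u + stepMoment P f idx xhat αhat t)) := by
    rw [← integral_const_mul]
    refine (integral_mono (hint.const_mul _) ((hMint.const_mul _).add (hintt.const_mul _))
      hpt).trans ?_
    simp only [Pi.add_apply]
    rw [integral_add (hMint.const_mul _) (hintt.const_mul _), integral_const_mul,
      integral_const_mul]
    have h2 : √Δ * √Δ = Δ := Real.mul_self_sqrt hΔ0
    rw [← mul_assoc, ← mul_div_assoc, h2]
    change _ + Δ / 2 * stepMoment P f idx xhat αhat t ≤ _
    linarith
  rcases hΔ0.eq_or_lt with h0 | h0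
  · -- no coordinate is ever updated
    have h3 : ∀ ω v, step f idx xhat αhat t ω v = 0 := by
      intro ω v
      by_contra hne
      have hv : v ∈ supp f (idx t ω) := by
        by_contra hv
        exact hne (step_apply_of_notMem_supp hv)
      have h4 := featureProb_le_sparsity (f := f) v
      rw [← hΔ, ← h0, featureProb] at h4
      have h5 : (0 : ℝ) < featureDegree f v := by exact_mod_cast featureDegree_pos hv
      have h6 : (0 : ℝ) < n := by exact_mod_cast (idx t ω).pos
      exact absurd h4 (not_le.2 (by positivity))
    simp [h3, ← h0]
  · exact le_of_mul_le_mul_left h1 (Real.sqrt_pos.2 h0)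

end IsRun

/-! ### Recursion for the virtual iterates -/

namespace IsRun

variable {n d : ℕ} {f : Fin n → Vec d → ℝ} {L μ γ : ℝ} {xstar x₀ : Vec d} {α₀ : Fin n → Vec d}
  {τ : ℕ} {Ω : Type*} [MeasurableSpace Ω] {P : Measure Ω} {sched : Ω → Schedule n d}
  {idx : ℕ → Ω → Fin n} {xhat : ℕ → Ω → Vec d} {αhat : ℕ → Ω → Fin n → Vec d}

theorem abs_xhat_sub_iterate_le (h : IsRun f γ x₀ α₀ τ P sched idx xhat αhat) (hγ : 0 ≤ γ)
    (t : ℕ) (ω : Ω) (v : Fin d) :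
    |xhat t ω v - iterate f γ x₀ idx xhat αhat t ω v| ≤
      γ * ∑ u ∈ Finset.Ico (t - τ) t, |step f idx xhat αhat u ω v| :=
  (h.execution ω).abs_xhat_sub_virtualIterate_le (h.after_read ω) (h.overlap ω) hγ t v

theorem card_overlap_le (t τ : ℕ) : ((Finset.Ico (t - τ) t).card : ℝ) ≤ τ := by
  rw [Nat.card_Ico]
  exact_mod_cast (by omega : t - (t - τ) ≤ τ)

variable [IsProbabilityMeasure P]

/-- The mean squared distance between the read and the virtual iterate. -/
theorem integral_sq_xhat_sub_iterate_le (h : IsRun f γ x₀ α₀ τ P sched idx xhat αhat)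
    (hγ : 0 ≤ γ) (t : ℕ) :
    ∫ ω, ‖xhat t ω - iterate f γ x₀ idx xhat αhat t ω‖ ^ 2 ∂P ≤
      γ ^ 2 * ((1 + τ * √(sparsity f)) *
        ∑ u ∈ Finset.Ico (t - τ) t, stepMoment P f idx xhat αhat u) := by
  set I := Finset.Ico (t - τ) t with hI
  set r := √(sparsity f) with hr
  have hr0 : 0 ≤ r := Real.sqrt_nonneg _
  have hlt : ∀ u ∈ I, u < t := fun u hu => (Finset.mem_Ico.1 hu).2
  have hint : ∀ u ∈ I, ∀ u' ∈ I, Integrable (fun ω => ∑ v,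
      |step f idx xhat αhat u ω v| * |step f idx xhat αhat u' ω v|) P := fun u hu u' hu' =>
    h.integrable_of_past ((past_step f (hlt u hu)).comp₂ (past_step f (hlt u' hu'))
      fun x y => ∑ v, |x v| * |y v|)
  have hpair : ∀ u u',
      ∫ ω, ∑ v, |step f idx xhat αhat u ω v| * |step f idx xhat αhat u' ω v| ∂P ≤
        (if u = u' then stepMoment P f idx xhat αhat u else 0) +
          r / 2 * (stepMoment P f idx xhat αhat u + stepMoment P f idx xhat αhat u') := by
    intro u u'
    have hN := stepMoment_nonneg (P := P) (f := f) (idx := idx) (xhat := xhat) (αhat := αhat)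
    rcases lt_trichotomy u u' with hlt | rfl | hlt
    · rw [if_neg hlt.ne, zero_add]
      exact h.integral_sum_abs_mul_abs_le hlt
    · rw [if_pos rfl]
      have h1 : ∀ ω, ∑ v, |step f idx xhat αhat u ω v| * |step f idx xhat αhat u ω v| =
          ‖step f idx xhat αhat u ω‖ ^ 2 := by
        intro ω
        rw [EuclideanSpace.real_norm_sq_eq]
        exact Finset.sum_congr rfl fun v _ => by rw [abs_mul_abs_self, sq]
      simp only [h1]
      refine le_add_of_nonneg_right (mul_nonneg (by positivity) (add_nonneg (hN u) (hN u)))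
    · rw [if_neg hlt.ne', zero_add, add_comm]
      simp only [mul_comm |step f idx xhat αhat u _ _|]
      exact h.integral_sum_abs_mul_abs_le hlt
  have hpt : ∀ ω, ‖xhat t ω - iterate f γ x₀ idx xhat αhat t ω‖ ^ 2 ≤
      γ ^ 2 * ∑ u ∈ I, ∑ u' ∈ I,
        ∑ v, |step f idx xhat αhat u ω v| * |step f idx xhat αhat u' ω v| := by
    intro ω
    have h1 : ∑ u ∈ I, ∑ u' ∈ I,
        ∑ v, |step f idx xhat αhat u ω v| * |step f idx xhat αhat u' ω v| =
        ∑ v, (∑ u ∈ I, |step f idx xhat αhat u ω v|) ^ 2 := by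
      simp only [sq, Finset.sum_mul_sum]
      rw [Finset.sum_comm (s := Finset.univ)]
      exact Finset.sum_congr rfl fun u _ => Finset.sum_comm
    rw [h1, EuclideanSpace.real_norm_sq_eq, Finset.mul_sum]
    refine Finset.sum_le_sum fun v _ => ?_
    rw [← mul_pow, PiLp.sub_apply, ← sq_abs]
    exact pow_le_pow_left₀ (abs_nonneg _) (h.abs_xhat_sub_iterate_le hγ t ω v) 2
  have hx : Past idx xhat αhat t (xhat t) := past_xhat le_rfl
  have hit : Past idx xhat αhat t (iterate f γ x₀ idx xhat αhat t) := past_virtualIterate f γ x₀ t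
  have hint2 : ∀ u ∈ I, Integrable (fun ω => ∑ u' ∈ I, ∑ v,
      |step f idx xhat αhat u ω v| * |step f idx xhat αhat u' ω v|) P :=
    fun u hu => integrable_finsetSum _ (hint u hu)
  refine (integral_mono (h.integrable_of_past (hx.comp₂ hit fun x y => ‖x - y‖ ^ 2))
    ((integrable_finsetSum _ hint2).const_mul _) hpt).trans ?_
  rw [integral_const_mul, integral_finsetSum _ hint2]
  refine mul_le_mul_of_nonneg_left ?_ (sq_nonneg γ)
  have h1 : ∀ u ∈ I, ∫ ω, ∑ u' ∈ I, ∑ v,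
      |step f idx xhat αhat u ω v| * |step f idx xhat αhat u' ω v| ∂P ≤
      ∑ u' ∈ I, ((if u = u' then stepMoment P f idx xhat αhat u else 0) +
          r / 2 * (stepMoment P f idx xhat αhat u + stepMoment P f idx xhat αhat u')) := by
    intro u hu
    rw [integral_finsetSum _ (hint u hu)]
    exact Finset.sum_le_sum fun u' _ => hpair u u'
  refine (Finset.sum_le_sum h1).trans ?_
  have h2 : ∑ u ∈ I, ∑ u' ∈ I, ((if u = u' then stepMoment P f idx xhat αhat u else 0) +
      r / 2 * (stepMoment P f idx xhat αhat u + stepMoment P f idx xhat αhat u')) =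
      (1 + I.card * r) * ∑ u ∈ I, stepMoment P f idx xhat αhat u := by
    simp only [Finset.sum_add_distrib, ← Finset.mul_sum, Finset.sum_const, nsmul_eq_mul,
      Finset.sum_ite_eq]
    rw [Finset.sum_congr rfl fun u hu => if_pos hu]
    ring
  rw [h2]
  refine mul_le_mul_of_nonneg_right ?_ (Finset.sum_nonneg fun u _ => stepMoment_nonneg u)
  have := mul_le_mul_of_nonneg_right (card_overlap_le t τ) hr0
  linarith

/-- The correlation between the current update and the updates that the read has missed. -/
theorem integral_inner_xhat_sub_iterate_le (h : IsRun f γ x₀ α₀ τ P sched idx xhat αhat)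
    (hγ : 0 ≤ γ) (t : ℕ) :
    ∫ ω, ⟪xhat t ω - iterate f γ x₀ idx xhat αhat t ω, step f idx xhat αhat t ω⟫_ℝ ∂P ≤
      γ * (√(sparsity f) / 2 * (∑ u ∈ Finset.Ico (t - τ) t, stepMoment P f idx xhat αhat u +
        τ * stepMoment P f idx xhat αhat t)) := by
  set I := Finset.Ico (t - τ) t with hI
  set r := √(sparsity f) with hr
  have hr0 : 0 ≤ r := Real.sqrt_nonneg _
  have hlt : ∀ u ∈ I, u < t := fun u hu => (Finset.mem_Ico.1 hu).2
  have hstep : Past idx xhat αhat (t + 1) (step f idx xhat αhat t) := past_step f t.lt_succ_self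
  have hx : Past idx xhat αhat (t + 1) (xhat t) := past_xhat t.le_succ
  have hit : Past idx xhat αhat (t + 1) (iterate f γ x₀ idx xhat αhat t) :=
    Past.mono (past_virtualIterate f γ x₀ t) t.le_succ
  have hint : ∀ u ∈ I, Integrable (fun ω => ∑ v,
      |step f idx xhat αhat u ω v| * |step f idx xhat αhat t ω v|) P := fun u hu =>
    h.integrable_of_past (((past_step f (hlt u hu)).mono t.le_succ).comp₂ hstep
      fun x y => ∑ v, |x v| * |y v|)
  have hpt : ∀ ω,
      ⟪xhat t ω - iterate f γ x₀ idx xhat αhat t ω, step f idx xhat αhat t ω⟫_ℝ ≤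
      γ * ∑ u ∈ I, ∑ v, |step f idx xhat αhat u ω v| * |step f idx xhat αhat t ω v| := by
    intro ω
    rw [Finset.sum_comm, PiLp.inner_apply, Finset.mul_sum]
    refine Finset.sum_le_sum fun v _ => ?_
    rw [← Finset.sum_mul, ← mul_assoc]
    refine (le_abs_self _).trans ?_
    rw [PiLp.sub_apply, real_inner_eq_re_inner, RCLike.inner_apply, conj_trivial, RCLike.re_to_real,
      abs_mul, mul_comm]
    exact mul_le_mul_of_nonneg_right (h.abs_xhat_sub_iterate_le hγ t ω v) (abs_nonneg _)
  refine (integral_mono (h.integrable_of_past ((hx.comp₂ hit fun x y => x - y).comp₂ hstep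
    fun x y => ⟪x, y⟫_ℝ)) ((integrable_finsetSum _ hint).const_mul _) hpt).trans ?_
  rw [integral_const_mul, integral_finsetSum _ hint]
  refine mul_le_mul_of_nonneg_left ?_ hγ
  refine (Finset.sum_le_sum fun u hu => h.integral_sum_abs_mul_abs_le (hlt u hu)).trans ?_
  rw [← Finset.mul_sum, Finset.sum_add_distrib, Finset.sum_const, nsmul_eq_mul]
  gcongr
  · exact stepMoment_nonneg t
  · exact_mod_cast card_overlap_le t τ

/-- The update direction is a descent direction in expectation, up to the distance between the read
and the virtual iterate. -/
theorem le_integral_inner_step (h : IsRun f γ x₀ α₀ τ P sched idx xhat αhat)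
    (hf : IsProblem f L μ) (hn : 0 < n) (hα₀ : ∀ i v, v ∉ supp f i → α₀ i v = 0)
    {σ : ℝ} (hσ0 : 0 ≤ σ) (hσ : σ ≤ μ) (t : ℕ) :
    excess P f xstar xhat t +
        σ / 4 * ∫ ω, ‖iterate f γ x₀ idx xhat αhat t ω - xstar‖ ^ 2 ∂P -
        σ / 2 * ∫ ω, ‖xhat t ω - iterate f γ x₀ idx xhat αhat t ω‖ ^ 2 ∂P ≤
      ∫ ω, ⟪xhat t ω - xstar, step f idx xhat αhat t ω⟫_ℝ ∂P := by
  have hx : Past idx xhat αhat t (xhat t) := past_xhat le_rfl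
  have hα : Past idx xhat αhat t (αhat t) := past_αhat le_rfl
  have hit : Past idx xhat αhat t (iterate f γ x₀ idx xhat αhat t) := past_virtualIterate f γ x₀ t
  have hX : ∀ i, Past idx xhat αhat t
      (fun ω => ⟪xhat t ω - xstar, direction f (xhat t ω) (αhat t ω) i⟫_ℝ) := fun i =>
    hx.comp₂ hα fun x α => ⟪x - xstar, direction f x α i⟫_ℝ
  have h1 : ∫ ω, ⟪xhat t ω - xstar, step f idx xhat αhat t ω⟫_ℝ ∂P =
      ∫ ω, ⟪xhat t ω - xstar, gradient (objective f) (xhat t ω)⟫_ℝ ∂P := by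
    refine (h.integral_comp_idx hX).trans ?_
    rw [← integral_finsetSum _ fun i _ => h.integrable_of_past (hX i), ← integral_const_mul]
    refine integral_congr_ae (Filter.Eventually.of_forall fun ω => ?_)
    simp only
    rw [← inner_sum, ← real_inner_smul_right, hf.gradient_objective]
    congr 2
    ext v
    simp only [WithLp.ofLp_sum, Finset.sum_apply]
    exact sum_direction_apply hn (xhat t ω)
      (fun i v hv => (h.execution ω).αhat_apply_of_notMem_supp hα₀ t i v hv) v
  have hi1 : Integrable (fun ω => objective f (xhat t ω) - objective f xstar) P :=
    h.integrable_of_past (hx.comp fun x => objective f x - objective f xstar)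
  have hi2 : Integrable (fun ω => ‖iterate f γ x₀ idx xhat αhat t ω - xstar‖ ^ 2) P :=
    h.integrable_of_past (hit.comp fun x => ‖x - xstar‖ ^ 2)
  have hi3 : Integrable (fun ω => ‖xhat t ω - iterate f γ x₀ idx xhat αhat t ω‖ ^ 2) P :=
    h.integrable_of_past (hx.comp₂ hit fun x y => ‖x - y‖ ^ 2)
  rw [h1, excess, ← integral_const_mul, ← integral_const_mul, ← integral_add hi1 (hi2.const_mul _),
    ← integral_sub (hi1.fun_add (hi2.const_mul _)) (hi3.const_mul _)]
  refine integral_mono ((hi1.add (hi2.const_mul _)).sub (hi3.const_mul _))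
    (h.integrable_of_past (hx.comp fun x => ⟪x - xstar, gradient (objective f) x⟫_ℝ)) fun ω => ?_
  refine le_trans ?_ (hf.inner_gradient_ge hσ (xhat t ω))
  have h2 : ‖iterate f γ x₀ idx xhat αhat t ω - xstar‖ ^ 2 ≤ 2 * ‖xhat t ω - xstar‖ ^ 2 +
      2 * ‖xhat t ω - iterate f γ x₀ idx xhat αhat t ω‖ ^ 2 := by
    have h3 := parallelogram_law_with_norm ℝ (xhat t ω - xstar)
      (xhat t ω - iterate f γ x₀ idx xhat αhat t ω)
    rw [sub_sub_sub_cancel_left] at h3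
    nlinarith [norm_nonneg (xhat t ω - xstar + (xhat t ω - iterate f γ x₀ idx xhat αhat t ω))]
  have h4 := mul_le_mul_of_nonneg_left h2 (by positivity : 0 ≤ σ / 4)
  simp only
  linarith

/-- One-step recursion for the distance of the virtual iterate to the minimizer. -/
theorem integral_sq_iterate_succ_le (h : IsRun f γ x₀ α₀ τ P sched idx xhat αhat)
    (hf : IsProblem f L μ) (hn : 0 < n) (hα₀ : ∀ i v, v ∉ supp f i → α₀ i v = 0)
    (hγ : 0 ≤ γ) {σ : ℝ} (hσ0 : 0 ≤ σ) (hσ : σ ≤ μ) (t : ℕ) :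
    ∫ ω, ‖iterate f γ x₀ idx xhat αhat (t + 1) ω - xstar‖ ^ 2 ∂P ≤
      (1 - γ * σ / 2) * ∫ ω, ‖iterate f γ x₀ idx xhat αhat t ω - xstar‖ ^ 2 ∂P -
      2 * γ * excess P f xstar xhat t +
      γ ^ 2 * (1 + τ * √(sparsity f)) * stepMoment P f idx xhat αhat t +
      γ ^ 2 * (√(sparsity f) + γ * σ * (1 + τ * √(sparsity f))) *
        ∑ u ∈ Finset.Ico (t - τ) t, stepMoment P f idx xhat αhat u := by
  have hstep : Past idx xhat αhat (t + 1) (step f idx xhat αhat t) := past_step f t.lt_succ_self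
  have hx : Past idx xhat αhat (t + 1) (xhat t) := past_xhat t.le_succ
  have hit : Past idx xhat αhat (t + 1) (iterate f γ x₀ idx xhat αhat t) :=
    Past.mono (past_virtualIterate f γ x₀ t) t.le_succ
  have hi1 : Integrable (fun ω => ‖iterate f γ x₀ idx xhat αhat t ω - xstar‖ ^ 2) P :=
    h.integrable_of_past (hit.comp fun x => ‖x - xstar‖ ^ 2)
  have hi2 : Integrable (fun ω => ⟪xhat t ω - xstar, step f idx xhat αhat t ω⟫_ℝ) P :=
    h.integrable_of_past (hx.comp₂ hstep fun x y => ⟪x - xstar, y⟫_ℝ)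
  have hi3 : Integrable (fun ω =>
      ⟪xhat t ω - iterate f γ x₀ idx xhat αhat t ω, step f idx xhat αhat t ω⟫_ℝ) P :=
    h.integrable_of_past ((hx.comp₂ hit fun x y => x - y).comp₂ hstep fun x y => ⟪x, y⟫_ℝ)
  have hi4 : Integrable (fun ω => ‖step f idx xhat αhat t ω‖ ^ 2) P :=
    h.integrable_of_past (hstep.comp fun x => ‖x‖ ^ 2)
  have hpt : ∀ ω, ‖iterate f γ x₀ idx xhat αhat (t + 1) ω - xstar‖ ^ 2 =
      ‖iterate f γ x₀ idx xhat αhat t ω - xstar‖ ^ 2 -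
      2 * γ * ⟪xhat t ω - xstar, step f idx xhat αhat t ω⟫_ℝ +
      2 * γ * ⟪xhat t ω - iterate f γ x₀ idx xhat αhat t ω, step f idx xhat αhat t ω⟫_ℝ +
      γ ^ 2 * ‖step f idx xhat αhat t ω‖ ^ 2 := by
    intro ω
    have h1 : iterate f γ x₀ idx xhat αhat (t + 1) ω - xstar =
        (iterate f γ x₀ idx xhat αhat t ω - xstar) - γ • step f idx xhat αhat t ω := by
      simp only [iterate, virtualIterate, step, Finset.sum_range_succ, smul_add]
      abel
    have h2 : iterate f γ x₀ idx xhat αhat t ω - xstar = (xhat t ω - xstar) -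
        (xhat t ω - iterate f γ x₀ idx xhat αhat t ω) := by abel
    rw [h1, norm_sub_sq_real, norm_smul, mul_pow, Real.norm_eq_abs, sq_abs,
      real_inner_smul_right]
    have h3 : ⟪iterate f γ x₀ idx xhat αhat t ω - xstar, step f idx xhat αhat t ω⟫_ℝ =
        ⟪xhat t ω - xstar, step f idx xhat αhat t ω⟫_ℝ -
        ⟪xhat t ω - iterate f γ x₀ idx xhat αhat t ω, step f idx xhat αhat t ω⟫_ℝ := by
      rw [← inner_sub_left, ← h2]
    rw [h3]
    ring
  simp only [hpt]
  have hi12 : Integrable (fun ω => ‖iterate f γ x₀ idx xhat αhat t ω - xstar‖ ^ 2 -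
      2 * γ * ⟪xhat t ω - xstar, step f idx xhat αhat t ω⟫_ℝ) P := hi1.sub (hi2.const_mul _)
  rw [integral_add (hi12.fun_add (hi3.const_mul _)) (hi4.const_mul _),
    integral_add hi12 (hi3.const_mul _),
    integral_sub hi1 (hi2.const_mul _), integral_const_mul, integral_const_mul,
    integral_const_mul]
  have h1 := mul_le_mul_of_nonneg_left
    (h.le_integral_inner_step hf hn hα₀ (xstar := xstar) hσ0 hσ t) (by positivity : 0 ≤ 2 * γ)
  have h2 := mul_le_mul_of_nonneg_left (h.integral_inner_xhat_sub_iterate_le hγ t)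
    (by positivity : 0 ≤ 2 * γ)
  have h3 := mul_le_mul_of_nonneg_left (h.integral_sq_xhat_sub_iterate_le hγ t)
    (by positivity : 0 ≤ γ * σ)
  change _ - _ + _ + γ ^ 2 * stepMoment P f idx xhat αhat t ≤ _
  linarith

end IsRun

/-! ### Geometric decay from a recursion with delays -/

/-- Weighted survival sum: the first `m` terms are not discounted, the others are geometric of ratio
`w * r < 1`, with sum at most `B`. -/
theorem sum_pow_mul_pow_sub_le {w r B : ℝ} (hw : 1 ≤ w) (hr : 0 ≤ r) (hB : 0 ≤ B)
    (hwr : 1 ≤ B * (1 - w * r)) (m K : ℕ) :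
    ∑ k ∈ Finset.range K, w ^ k * r ^ (k - m) ≤ w ^ m * (m + B) := by
  have hw0 : 0 ≤ w := zero_le_one.trans hw
  have h1 : ∀ k ∈ Finset.range K, w ^ k * r ^ (k - m) ≤ w ^ m * (w * r) ^ (k - m) := by
    intro k _
    rw [mul_pow, ← mul_assoc, ← pow_add]
    exact mul_le_mul_of_nonneg_right (pow_le_pow_right₀ hw (by omega)) (pow_nonneg hr _)
  refine (Finset.sum_le_sum h1).trans ?_
  rw [← Finset.mul_sum]
  refine mul_le_mul_of_nonneg_left ?_ (pow_nonneg hw0 m)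
  have hwr0 : 0 ≤ w * r := mul_nonneg hw0 hr
  have h2 : ∑ k ∈ Finset.range K, (w * r) ^ (k - m) ≤
      ∑ k ∈ Finset.range (m + K), (w * r) ^ (k - m) :=
    Finset.sum_le_sum_of_subset_of_nonneg (Finset.range_mono (Nat.le_add_left K m))
      fun _ _ _ => pow_nonneg hwr0 _
  refine h2.trans ?_
  rw [Finset.sum_range_add]
  have h3 : ∑ k ∈ Finset.range m, (w * r) ^ (k - m) = m := by
    rw [Finset.sum_congr rfl fun k hk => by
      rw [Nat.sub_eq_zero_of_le (Finset.mem_range.1 hk).le, pow_zero]]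
    simp
  simp only [Nat.add_sub_cancel_left]
  rw [h3]
  refine add_le_add le_rfl ?_
  have h4 := geom_sum_mul_neg (w * r) K
  have h5 : 0 ≤ (w * r) ^ K := pow_nonneg hwr0 _
  have h6 : 0 ≤ ∑ k ∈ Finset.range K, (w * r) ^ k :=
    Finset.sum_nonneg fun _ _ => pow_nonneg hwr0 _
  have h7 := mul_le_mul_of_nonneg_left hwr h6
  nlinarith

/-- A delay of at most `τ` costs a factor `τ` and the growth of the weights over `τ` steps. -/
theorem sum_pow_mul_sum_Ico_le {w c : ℝ} (hw : 1 ≤ w) {N : ℕ → ℝ} (hN : ∀ t, 0 ≤ N t) {τ : ℕ}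
    (hc : w ^ τ ≤ c) (M : ℕ) :
    ∑ t ∈ Finset.range M, w ^ (t + 1) * ∑ u ∈ Finset.Ico (t - τ) t, N u ≤
      c * τ * ∑ u ∈ Finset.range M, w ^ (u + 1) * N u := by
  have hw0 : 0 ≤ w := zero_le_one.trans hw
  simp only [Finset.mul_sum]
  rw [Finset.sum_comm' (t' := Finset.range M)
    (s' := fun u => Finset.Ico (u + 1) (min M (u + τ + 1))) (by
      intro t u; simp only [Finset.mem_range, Finset.mem_Ico, lt_min_iff]; omega)]
  refine Finset.sum_le_sum fun u _ => ?_
  have h1 : ∀ t ∈ Finset.Ico (u + 1) (min M (u + τ + 1)),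
      w ^ (t + 1) * N u ≤ c * (w ^ (u + 1) * N u) := by
    intro t ht
    rw [Finset.mem_Ico, lt_min_iff] at ht
    have h2 : w ^ (t + 1) ≤ w ^ τ * w ^ (u + 1) := by
      rw [← pow_add]; exact pow_le_pow_right₀ hw (by omega)
    rw [← mul_assoc]
    exact mul_le_mul_of_nonneg_right
      (h2.trans (mul_le_mul_of_nonneg_right hc (pow_nonneg hw0 _))) (hN u)
  refine (Finset.sum_le_card_nsmul _ _ _ h1).trans ?_
  rw [nsmul_eq_mul, Nat.card_Ico]
  have h2 : ((min M (u + τ + 1) - (u + 1) : ℕ) : ℝ) ≤ τ := by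
    exact_mod_cast (by omega : min M (u + τ + 1) - (u + 1) ≤ τ)
  have h3 : 0 ≤ c * (w ^ (u + 1) * N u) :=
    mul_nonneg ((pow_nonneg hw0 τ).trans hc) (mul_nonneg (pow_nonneg hw0 _) (hN u))
  refine (mul_le_mul_of_nonneg_right h2 h3).trans (le_of_eq (by ring))

theorem sum_pow_mul_sum_pow_sub_le {w r B : ℝ} (hw : 1 ≤ w) (hr : 0 ≤ r) (hB : 0 ≤ B)
    (hwr : 1 ≤ B * (1 - w * r)) {e : ℕ → ℝ} (he : ∀ t, 0 ≤ e t) (m M : ℕ) :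
    ∑ t ∈ Finset.range M, w ^ (t + 1) * ∑ u ∈ Finset.range t, r ^ (t - (u + 1 + m)) * e u ≤
      w ^ (m + 1) * (m + B) * ∑ u ∈ Finset.range M, w ^ (u + 1) * e u := by
  have hw0 : 0 ≤ w := zero_le_one.trans hw
  simp only [Finset.mul_sum]
  rw [Finset.sum_comm' (t' := Finset.range M) (s' := fun u => Finset.Ico (u + 1) M) (by
      intro t u; simp only [Finset.mem_range, Finset.mem_Ico]; omega)]
  refine Finset.sum_le_sum fun u _ => ?_
  rw [Finset.sum_Ico_eq_sum_range]
  have h1 : ∀ k ∈ Finset.range (M - (u + 1)),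
      w ^ (u + 1 + k + 1) * (r ^ (u + 1 + k - (u + 1 + m)) * e u) =
        (w ^ (u + 2) * e u) * (w ^ k * r ^ (k - m)) := by
    intro k _
    rw [Nat.add_sub_add_left]
    ring
  rw [Finset.sum_congr rfl h1, ← Finset.mul_sum]
  refine (mul_le_mul_of_nonneg_left (sum_pow_mul_pow_sub_le hw hr hB hwr m _)
    (mul_nonneg (pow_nonneg hw0 _) (he u))).trans (le_of_eq (by ring))

/-- Multiplying the recursion by `(1 - ρ)^{-(t + 1)}` and summing over `t`, the step moments are
absorbed by the excess terms provided that the step size is small. The bounds on `ρ` keep the weights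
nearly constant over an overlap, `(1 - ρ)^{-(2τ + 1)} ≤ 16/15`, which is where `16/15` and its multiple
`64/15` come from; `H + 5/4` bounds the weighted
lifetime `2τ + 5n/4` of a stored gradient, in units of `n`. -/
theorem excess_le_of_recursion {a e N A : ℕ → ℝ} {γ L ρ C₁ C₂ S H : ℝ} {n τ : ℕ} (hn : 0 < n)
    (hγ : 0 < γ) (hL : 0 < L) (hρ0 : 0 ≤ ρ) (hC₁ : 0 ≤ C₁) (hC₂ : 0 ≤ C₂) (hS : 0 ≤ S)
    (ha : ∀ t, 0 ≤ a t) (he : ∀ t, 0 ≤ e t) (hN : ∀ t, 0 ≤ N t)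
    (hrec : ∀ t, a (t + 1) ≤ (1 - ρ) * a t - 2 * γ * e t + γ ^ 2 * C₁ * N t +
      γ ^ 2 * C₂ * ∑ u ∈ Finset.Ico (t - τ) t, N u)
    (hNle : ∀ t, N t ≤ 4 * L * e t + 2 * A t)
    (hA : ∀ t, A t ≤ 2 * L / n * ∑ u ∈ Finset.range t,
        (1 - 1 / (n : ℝ)) ^ (t - (u + 1 + 2 * τ)) * e u +
      1 / n * ((1 - 1 / (n : ℝ)) ^ (t - τ) * S))
    (hρn : ρ ≤ 1 / (20 * n)) (hρτ : ρ * (2 * τ + 1) ≤ 1 / 16) (hH : 2 * τ ≤ H * n)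
    (hstep : γ * L * (C₁ + 16 / 15 * τ * C₂) * (4 + 64 / 15 * (H + 5 / 4)) ≤ 1) (T : ℕ) :
    γ * e T ≤ (1 - ρ) ^ T * (a 0 + γ / (2 * L) * S) := by
  have hn1 : (1 : ℝ) ≤ n := by exact_mod_cast hn
  have hn0 : (0 : ℝ) < n := by positivity
  have hρ20 : ρ ≤ 1 / 20 := hρn.trans (by
    apply one_div_le_one_div_of_le <;> linarith)
  have hH0 : 0 ≤ H := by
    by_contra hneg
    have : H * n < 0 := mul_neg_of_neg_of_pos (not_le.1 hneg) hn0
    have h2 : (0 : ℝ) ≤ 2 * τ := by positivity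
    linarith
  obtain ⟨w, hw⟩ : ∃ w, w = (1 - ρ)⁻¹ := ⟨_, rfl⟩
  have hwρ : w * (1 - ρ) = 1 := by rw [hw]; exact inv_mul_cancel₀ (by linarith)
  have hw1 : 1 ≤ w := by rw [hw]; exact (one_le_inv₀ (by linarith)).2 (by linarith)
  have hw0 : 0 ≤ w := zero_le_one.trans hw1
  have hwτ : w ^ (2 * τ + 1) ≤ 16 / 15 := by
    have h1 : 15 / 16 ≤ (1 - ρ) ^ (2 * τ + 1) := by
      have h2 := one_add_mul_le_pow (show (-2 : ℝ) ≤ -ρ by linarith) (2 * τ + 1)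
      push_cast at h2
      rw [← sub_eq_add_neg] at h2
      linarith
    have h3 : w ^ (2 * τ + 1) * (1 - ρ) ^ (2 * τ + 1) = 1 := by rw [← mul_pow, hwρ, one_pow]
    have h4 := mul_le_mul_of_nonneg_left h1 (pow_nonneg hw0 (2 * τ + 1))
    linarith
  set r : ℝ := 1 - 1 / n with hr
  have hr0 : 0 ≤ r := by rw [hr, sub_nonneg, div_le_one hn0]; exact hn1
  -- `w r ≤ 1 - 4/(5n)`: the memory is refreshed faster than the weights grow
  have hwr : 1 ≤ 5 * n / 4 * (1 - w * r) := by
    have h1 : w * r ≤ 1 - 4 / (5 * n) := by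
      have h2 : r ≤ (1 - ρ) * (1 - 4 / (5 * n)) := by
        have h3 : 0 ≤ ρ * (4 / (5 * n)) := by positivity
        have h4 : (1 : ℝ) / n = 4 / (5 * n) + 4 * (1 / (20 * n)) := by field_simp; norm_num
        have h5 : (0 : ℝ) ≤ 1 / (20 * n) := by positivity
        rw [hr]
        nlinarith
      calc w * r ≤ w * ((1 - ρ) * (1 - 4 / (5 * n))) := mul_le_mul_of_nonneg_left h2 hw0
        _ = 1 - 4 / (5 * n) := by rw [← mul_assoc, hwρ, one_mul]
    calc (1 : ℝ) = 5 * n / 4 * (4 / (5 * n)) := by field_simp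
      _ ≤ 5 * n / 4 * (1 - w * r) := mul_le_mul_of_nonneg_left (by linarith) (by positivity)
  have hB0 : (0 : ℝ) ≤ 5 * n / 4 := by positivity
  -- the telescoping sum
  have htel : ∀ M, w ^ M * a M + 2 * γ * ∑ t ∈ Finset.range M, w ^ (t + 1) * e t ≤
      a 0 + γ ^ 2 * C₁ * ∑ t ∈ Finset.range M, w ^ (t + 1) * N t +
      γ ^ 2 * C₂ * ∑ t ∈ Finset.range M, w ^ (t + 1) * ∑ u ∈ Finset.Ico (t - τ) t, N u := by
    intro M
    induction M with
    | zero => simp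
    | succ M ih =>
      rw [Finset.sum_range_succ, Finset.sum_range_succ, Finset.sum_range_succ]
      have h1 := mul_le_mul_of_nonneg_left (hrec M) (pow_nonneg hw0 (M + 1))
      have h2 : w ^ (M + 1) * ((1 - ρ) * a M) = w ^ M * a M := by
        rw [pow_succ, ← mul_assoc, mul_assoc (w ^ M), hwρ, mul_one]
      linarith
  obtain ⟨E, hE⟩ : ∃ E, E = ∑ t ∈ Finset.range (T + 1), w ^ (t + 1) * e t := ⟨_, rfl⟩
  obtain ⟨NN, hNN⟩ : ∃ NN, NN = ∑ t ∈ Finset.range (T + 1), w ^ (t + 1) * N t := ⟨_, rfl⟩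
  have hE0 : 0 ≤ E := by
    rw [hE]; exact Finset.sum_nonneg fun t _ => mul_nonneg (pow_nonneg hw0 _) (he t)
  have hwτ' : w ^ τ ≤ 16 / 15 := (pow_le_pow_right₀ hw1 (by omega)).trans hwτ
  have hwτ'' : w ^ (τ + 1) ≤ 16 / 15 := (pow_le_pow_right₀ hw1 (by omega)).trans hwτ
  have hdelay := sum_pow_mul_sum_Ico_le hw1 hN hwτ' (T + 1)
  have hmem : ∑ t ∈ Finset.range (T + 1), w ^ (t + 1) * A t ≤
      16 / 15 * (H + 5 / 4) * (2 * L * E + S) := by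
    have h1 := sum_pow_mul_sum_pow_sub_le hw1 hr0 hB0 hwr he (2 * τ) (T + 1)
    have h2 := sum_pow_mul_pow_sub_le hw1 hr0 hB0 hwr τ (T + 1)
    have h3 : ∑ t ∈ Finset.range (T + 1), w ^ (t + 1) * A t ≤
        2 * L / n * ∑ t ∈ Finset.range (T + 1),
          w ^ (t + 1) * ∑ u ∈ Finset.range t, r ^ (t - (u + 1 + 2 * τ)) * e u +
        1 / n * S * w * ∑ t ∈ Finset.range (T + 1), w ^ t * r ^ (t - τ) := by
      rw [Finset.mul_sum, Finset.mul_sum, ← Finset.sum_add_distrib]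
      refine Finset.sum_le_sum fun t _ => ?_
      refine (mul_le_mul_of_nonneg_left (hA t) (pow_nonneg hw0 (t + 1))).trans (le_of_eq ?_)
      ring
    rw [← hE] at h1
    push_cast at h1
    have h4 : w ^ (2 * τ + 1) * (2 * τ + 5 * n / 4) * E ≤ 16 / 15 * ((H + 5 / 4) * n) * E := by
      refine mul_le_mul_of_nonneg_right ?_ hE0
      refine mul_le_mul hwτ (by linarith) (by positivity) (by norm_num)
    have h5 : w * (w ^ τ * (τ + 5 * n / 4)) ≤ 16 / 15 * ((H + 5 / 4) * n) := by
      rw [← mul_assoc, ← pow_succ']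
      have : (0 : ℝ) ≤ τ := by positivity
      refine mul_le_mul hwτ'' (by linarith) (by positivity) (by norm_num)
    have h6 := mul_le_mul_of_nonneg_left (h1.trans h4) (by positivity : 0 ≤ 2 * L / n)
    have h7 := mul_le_mul_of_nonneg_left ((mul_le_mul_of_nonneg_left h2 hw0).trans h5)
      (by positivity : 0 ≤ 1 / n * S)
    have h8 : 2 * L / n * (16 / 15 * ((H + 5 / 4) * n) * E) + 1 / n * S *
        (16 / 15 * ((H + 5 / 4) * n)) = 16 / 15 * (H + 5 / 4) * (2 * L * E + S) := by
      field_simp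
    linarith
  have hNNle : NN ≤ (4 + 64 / 15 * (H + 5 / 4)) * (L * E) + 32 / 15 * (H + 5 / 4) * S := by
    have h1 : NN ≤ 4 * L * E + 2 * ∑ t ∈ Finset.range (T + 1), w ^ (t + 1) * A t := by
      rw [hNN, hE, Finset.mul_sum, Finset.mul_sum, ← Finset.sum_add_distrib]
      refine Finset.sum_le_sum fun t _ => ?_
      have := mul_le_mul_of_nonneg_left (hNle t) (pow_nonneg hw0 (t + 1))
      linarith
    linarith
  obtain ⟨Q, hQ⟩ : ∃ Q, Q = C₁ + 16 / 15 * τ * C₂ := ⟨_, rfl⟩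
  have hQ0 : 0 ≤ Q := by rw [hQ]; positivity
  rw [← hQ] at hstep
  have hmain : 2 * γ * E ≤ a 0 + γ ^ 2 * Q * NN := by
    have h1 := htel (T + 1)
    rw [← hE, ← hNN] at h1
    rw [← hNN] at hdelay
    have h2 := mul_le_mul_of_nonneg_left hdelay (by positivity : 0 ≤ γ ^ 2 * C₂)
    have h3 := mul_nonneg (pow_nonneg hw0 (T + 1)) (ha (T + 1))
    rw [hQ]
    linarith
  have hγE : γ * E ≤ a 0 + γ / (2 * L) * S := by
    have h1 := mul_le_mul_of_nonneg_left hNNle (by positivity : 0 ≤ γ ^ 2 * Q)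
    have h2 := mul_le_mul_of_nonneg_left hstep (by positivity : 0 ≤ γ * E)
    have h3 : γ ^ 2 * Q * (32 / 15 * (H + 5 / 4) * S) ≤ γ / (2 * L) * S := by
      have h4 : γ * L * Q * (64 / 15 * (H + 5 / 4)) ≤ 1 := by
        have : 0 ≤ γ * L * Q * 4 := by positivity
        linarith
      have h5 := mul_le_mul_of_nonneg_left h4 (by positivity : 0 ≤ γ / (2 * L) * S)
      refine (le_of_eq ?_).trans (h5.trans (le_of_eq (mul_one _)))
      field_simp
      ring
    linarith
  have hlast : w ^ (T + 1) * e T ≤ E := by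
    rw [hE]
    exact Finset.single_le_sum (f := fun t => w ^ (t + 1) * e t)
      (fun t _ => mul_nonneg (pow_nonneg hw0 _) (he t)) (Finset.self_mem_range_succ T)
  have hq : (0 : ℝ) ≤ (1 - ρ) ^ T := pow_nonneg (by linarith) T
  have h1 : w ^ T * e T ≤ E :=
    (mul_le_mul_of_nonneg_right (pow_le_pow_right₀ hw1 T.le_succ) (he T)).trans hlast
  have h2 : (1 - ρ) ^ T * (γ * (w ^ T * e T)) = γ * e T := by
    have : w ^ T * (1 - ρ) ^ T = 1 := by rw [← mul_pow, hwρ, one_pow]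
    linear_combination (γ * e T) * this
  rw [← h2]
  exact mul_le_mul_of_nonneg_left ((mul_le_mul_of_nonneg_left h1 hγ.le).trans hγE) hq

/-! ### Rates and step sizes -/

/-- Convergence of a run under explicit smallness conditions on the step size and the rate factor.
The strong convexity modulus `μ` may be replaced by any smaller `σ`: the well-conditioned regime is
reached with the universal step size by not exploiting all the strong convexity. -/
theorem IsRun.convergesAtRate {n d : ℕ} {f : Fin n → Vec d → ℝ} {L μ γ : ℝ} {xstar x₀ : Vec d}
    {α₀ : Fin n → Vec d} {τ : ℕ} {Ω : Type*} [MeasurableSpace Ω] {P : Measure Ω}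
    [IsProbabilityMeasure P] {sched : Ω → Schedule n d} {idx : ℕ → Ω → Fin n}
    {xhat : ℕ → Ω → Vec d} {αhat : ℕ → Ω → Fin n → Vec d}
    (h : IsRun f γ x₀ α₀ τ P sched idx xhat αhat) (hf : IsProblem f L μ) (hn : 0 < n)
    (hmin : ∀ x, objective f xstar ≤ objective f x) (hα₀ : ∀ i v, v ∉ supp f i → α₀ i v = 0)
    (hγ : 0 < γ) (hγL : γ * L ≤ 1) {σ ρ H : ℝ} (hσ0 : 0 ≤ σ) (hσ : σ ≤ μ) (hρ0 : 0 ≤ ρ)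
    (hργ : ρ ≤ γ * σ / 2) (hρn : ρ ≤ 1 / (20 * n)) (hρτ : ρ * (2 * τ + 1) ≤ 1 / 16)
    (hH : 2 * τ ≤ H * n)
    (hstep : γ * L * ((1 + τ * √(sparsity f)) + 16 / 15 * τ *
      (√(sparsity f) + γ * σ * (1 + τ * √(sparsity f)))) * (4 + 64 / 15 * (H + 5 / 4)) ≤ 1) :
    ConvergesAtRate f xstar P xhat ρ (5 / 2 * (n / γ) * initialError f L xstar x₀ α₀) := by
  intro T
  have hi : Integrable (fun ω => objective f (xhat T ω)) P :=
    h.integrable_of_past ((past_xhat (t := T) le_rfl).comp (objective f))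
  refine ⟨hi, ?_⟩
  have hL := hf.L_pos
  have he : (∫ ω, objective f (xhat T ω) ∂P) - objective f xstar = excess P f xstar xhat T := by
    rw [excess, integral_sub hi (integrable_const _)]
    simp
  rw [he]
  set S := ∑ j, ‖α₀ j - gradient (f j) xstar‖ ^ 2 with hS
  have hS0 : 0 ≤ S := Finset.sum_nonneg fun _ _ => sq_nonneg _
  have hdist0 : ∀ t, 0 ≤ ∫ ω, ‖iterate f γ x₀ idx xhat αhat t ω - xstar‖ ^ 2 ∂P := fun t =>
    integral_nonneg fun _ => sq_nonneg _
  have hrec : ∀ t, ∫ ω, ‖iterate f γ x₀ idx xhat αhat (t + 1) ω - xstar‖ ^ 2 ∂P ≤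
      (1 - ρ) * ∫ ω, ‖iterate f γ x₀ idx xhat αhat t ω - xstar‖ ^ 2 ∂P -
      2 * γ * excess P f xstar xhat t +
      γ ^ 2 * (1 + τ * √(sparsity f)) * stepMoment P f idx xhat αhat t +
      γ ^ 2 * (√(sparsity f) + γ * σ * (1 + τ * √(sparsity f))) *
        ∑ u ∈ Finset.Ico (t - τ) t, stepMoment P f idx xhat αhat u := by
    intro t
    refine (h.integral_sq_iterate_succ_le hf hn hα₀ hγ.le hσ0 hσ t).trans ?_
    have h2 := mul_le_mul_of_nonneg_right hργ (hdist0 t)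
    linarith
  have h1 := excess_le_of_recursion
    (a := fun t => ∫ ω, ‖iterate f γ x₀ idx xhat αhat t ω - xstar‖ ^ 2 ∂P)
    (e := excess P f xstar xhat) (N := stepMoment P f idx xhat αhat)
    (A := memError P f xstar αhat) (C₁ := 1 + τ * √(sparsity f))
    (C₂ := √(sparsity f) + γ * σ * (1 + τ * √(sparsity f))) hn hγ hL hρ0 (by positivity)
    (by positivity) hS0 hdist0 (excess_nonneg hmin) stepMoment_nonneg hrec
    (h.stepMoment_le hf hn hmin hα₀) (h.memError_le hf hn hmin hα₀) hρn hρτ hH hstep T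
  have h0 : ∫ ω, ‖iterate f γ x₀ idx xhat αhat 0 ω - xstar‖ ^ 2 ∂P = ‖x₀ - xstar‖ ^ 2 := by
    simp [iterate, virtualIterate]
  simp only [h0] at h1
  clear_value S
  have hn1 : (1 : ℝ) ≤ n := by exact_mod_cast hn
  have hq : 0 ≤ (1 - ρ) ^ T := pow_nonneg (by
    have : (1 : ℝ) / (20 * n) ≤ 1 := by
      rw [div_le_one (by positivity)]; linarith
    linarith) T
  have h2 : ‖x₀ - xstar‖ ^ 2 + γ / (2 * L) * S ≤ 5 / 2 * n * initialError f L xstar x₀ α₀ := by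
    have h3 : γ / (2 * L) * S ≤ 5 / 2 * (1 / (5 * L ^ 2) * S) := by
      have h4 := mul_le_mul_of_nonneg_right hγL (by positivity : 0 ≤ 1 / (2 * L ^ 2) * S)
      refine (le_of_eq ?_).trans (h4.trans (le_of_eq ?_)) <;> field_simp
    have h5 : 0 ≤ initialError f L xstar x₀ α₀ := by
      rw [initialError, ← hS]
      exact add_nonneg (sq_nonneg _) (mul_nonneg (by positivity) hS0)
    have h6 : ‖x₀ - xstar‖ ^ 2 + γ / (2 * L) * S ≤ 5 / 2 * initialError f L xstar x₀ α₀ := by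
      rw [initialError, ← hS]
      have := sq_nonneg ‖x₀ - xstar‖
      linarith
    refine h6.trans ?_
    have := mul_le_mul_of_nonneg_right hn1 h5
    linarith
  have h7 := h1.trans (mul_le_mul_of_nonneg_left h2 hq)
  rw [← le_div_iff₀' hγ] at h7
  exact h7.trans (le_of_eq (by ring))

theorem mul_sagaRate_le {n : ℕ} {κ c a : ℝ} (hκ : 0 < κ) (hc : 0 ≤ c) (ha1 : a ≤ 1) :
    c * sagaRate n κ a ≤ c * min (1 / (n : ℝ)) (1 / κ) := by
  refine mul_le_mul_of_nonneg_left ?_ hc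
  have h1 : min (1 / (n : ℝ)) (a * (1 / κ)) ≤ min (1 / (n : ℝ)) (1 / κ) :=
    min_le_min le_rfl (mul_le_of_le_one_left (by positivity) ha1)
  have h2 : 0 ≤ min (1 / (n : ℝ)) (1 / κ) := le_min (by positivity) (by positivity)
  unfold sagaRate
  linarith

/-- Also valid for `r = 0`, where `1 / r = 0`. -/
theorem mul_le_of_le_one_div_mul {r τ c : ℝ} (hr : 0 ≤ r) (hc : 0 ≤ c) (hτ : τ ≤ 1 / r * c) : τ * r ≤ c := by
  have h1 := mul_le_mul_of_nonneg_right hτ hr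
  have h2 : 1 / r * r ≤ 1 := by
    rcases hr.eq_or_lt with h | h
    · simp [← h]
    · rw [one_div_mul_cancel h.ne']
  have h3 := mul_le_mul_of_nonneg_right h2 hc
  linarith

theorem xi_pos {κ Δ τ : ℝ} (hκ : 0 < κ) (hτ : 0 ≤ τ) : 0 < xi κ Δ τ := by
  refine Real.sqrt_pos.2 ?_
  have : 0 ≤ min (1 / √Δ) τ := le_min (by positivity) hτ
  positivity

theorem xi_sq {κ Δ τ : ℝ} (hκ : 0 < κ) (hτ : 0 ≤ τ) :
    xi κ Δ τ ^ 2 = 1 + 1 / (8 * κ) * min (1 / √Δ) τ := by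
  refine Real.sq_sqrt ?_
  have : 0 ≤ min (1 / √Δ) τ := le_min (by positivity) hτ
  positivity

theorem one_le_xi {κ Δ τ : ℝ} (hκ : 0 < κ) (hτ : 0 ≤ τ) : 1 ≤ xi κ Δ τ := by
  refine Real.one_le_sqrt.2 (le_add_of_nonneg_right ?_)
  have : 0 ≤ min (1 / √Δ) τ := le_min (by positivity) hτ
  positivity

/-- The step size `a*(τ) / L` is small enough for the recursion. The factor `ξ` in `a*(τ)`
compensates for the term due to the strong convexity. When `Δ = 0` the minimum in `ξ` is `0`, as
`1 / √0 = 0`, and the claim needs `τ = 0`. -/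
theorem aStar_mul_le {κ Δ τ : ℝ} (hκ : 0 < κ) (hτ : 0 ≤ τ) (hΔτ : √Δ = 0 → τ = 0) :
    aStar κ Δ τ * ((1 + τ * √Δ) + 16 / 15 * τ * (√Δ + aStar κ Δ τ / κ * (1 + τ * √Δ))) ≤
      7 / 96 := by
  set r := √Δ with hr
  have hr0 : 0 ≤ r := Real.sqrt_nonneg _
  set m := min (1 / r) τ with hm
  set ξ := xi κ Δ τ with hξdef
  have hξ : 0 < ξ := xi_pos hκ hτ
  have hξ1 : 1 ≤ ξ := one_le_xi hκ hτ
  have hξ2 : ξ ^ 2 = 1 + 1 / (8 * κ) * m := xi_sq hκ hτ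
  have hs : 0 ≤ τ * r := mul_nonneg hτ hr0
  obtain ⟨a, ha⟩ : ∃ a, a = aStar κ Δ τ := ⟨_, rfl⟩
  have ha' : a * (1 + τ * r) * ξ = 1 / 32 := by
    rw [ha, aStar, ← hr, ← hξdef]
    field_simp
  rw [← ha]
  have ha0 : 0 < a := by rw [ha, aStar]; positivity
  have h1 : a * (1 + τ * r) ≤ 1 / 32 := by
    rw [← ha']
    exact le_mul_of_one_le_right (by positivity) hξ1
  have h2 : a * (τ * r) ≤ 1 / 32 := by linarith
  have h3 : τ ≤ m * (1 + τ * r) := by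
    rcases hr0.eq_or_lt with h0 | h0
    · rw [hΔτ h0.symm]
      have : 0 ≤ m := le_min (by positivity) hτ
      positivity
    · rcases le_total (1 / r) τ with hle | hle
      · rw [hm, min_eq_left hle]
        have : 1 / r * (1 + τ * r) = 1 / r + τ := by field_simp
        rw [this]
        linarith [one_div_pos.2 h0]
      · rw [hm, min_eq_right hle]
        exact le_mul_of_one_le_right hτ (by linarith)
  have h4 : a * τ * (a / κ * (1 + τ * r)) ≤ 1 / 128 := by
    have h5 := mul_le_mul_of_nonneg_left h3 (by positivity : 0 ≤ a ^ 2 * (1 + τ * r) / κ)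
    have h6 : m / κ ≤ 8 * ξ ^ 2 := by
      rw [hξ2]
      have : 8 * (1 / (8 * κ) * m) = m / κ := by field_simp
      linarith
    have h7 := mul_le_mul_of_nonneg_left h6 (by positivity : 0 ≤ (a * (1 + τ * r)) ^ 2)
    have h8 : (a * (1 + τ * r)) ^ 2 * (8 * ξ ^ 2) = 1 / 128 := by
      have : (a * (1 + τ * r)) ^ 2 * (8 * ξ ^ 2) = 8 * (a * (1 + τ * r) * ξ) ^ 2 := by ring
      rw [this, ha']
      norm_num
    rw [h8] at h7
    refine le_trans (le_of_eq ?_) (h5.trans (le_trans (le_of_eq ?_) h7)) <;> ring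
  linarith

/-- Lower bound on the step size that gives the rate `min (1/n) (1/κ)` up to a constant. -/
theorem le_aStar {κ Δ τ N C : ℝ} (hκ : 0 < κ) (hτ : 0 ≤ τ) (hC : 0 ≤ C)
    (hτN : τ ≤ N / 10) (hτC : τ ≤ C * (1 / √Δ * max 1 (N / κ))) :
    1 / (64 * (1 + C) * max 1 (N / κ)) ≤ aStar κ Δ τ := by
  set R := max 1 (N / κ) with hR
  have hR1 : 1 ≤ R := le_max_left _ _
  have hRN : N / κ ≤ R := le_max_right _ _
  set r := √Δ with hr
  have hr0 : 0 ≤ r := Real.sqrt_nonneg _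
  set m := min (1 / r) τ with hm
  have hm0 : 0 ≤ m := le_min (by positivity) hτ
  set ξ := xi κ Δ τ with hξdef
  have hξ : 0 < ξ := xi_pos hκ hτ
  have hξ2 : ξ ^ 2 = 1 + 1 / (8 * κ) * m := xi_sq hκ hτ
  have hs0 : 0 ≤ τ * r := mul_nonneg hτ hr0
  have hs : τ * r ≤ C * R := mul_le_of_le_one_div_mul hr0 (by positivity) (hτC.trans (le_of_eq (by ring)))
  have hsR : 1 + τ * r ≤ (1 + C) * R := by linarith
  have hmr : m * r ≤ 1 := mul_le_of_le_one_div_mul hr0 zero_le_one ((min_le_left _ _).trans (by rw [mul_one]))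
  have hmτ : (1 + τ * r) * m ≤ 2 * τ := by
    have h1 := mul_le_mul_of_nonneg_left hmr hτ
    have h2 : m ≤ τ := min_le_right _ _
    linarith
  have hmR : (1 + τ * r) * (1 / (8 * κ) * m) ≤ R := by
    have h1 : (1 + τ * r) * (1 / (8 * κ) * m) ≤ 1 / (8 * κ) * (N / 5) := by
      have := mul_le_mul_of_nonneg_left (hmτ.trans (by linarith : 2 * τ ≤ N / 5))
        (by positivity : 0 ≤ 1 / (8 * κ))
      linarith
    have h2 : 1 / (8 * κ) * (N / 5) = 1 / 40 * (N / κ) := by ring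
    linarith
  have hsq : ((1 + τ * r) * ξ) ^ 2 ≤ (2 * (1 + C) * R) ^ 2 := by
    have h1 : ((1 + τ * r) * ξ) ^ 2 =
        (1 + τ * r) * ((1 + τ * r) + (1 + τ * r) * (1 / (8 * κ) * m)) := by
      rw [mul_pow, hξ2]; ring
    have hCR : 0 ≤ C * R := by positivity
    rw [h1]
    calc (1 + τ * r) * ((1 + τ * r) + (1 + τ * r) * (1 / (8 * κ) * m))
        ≤ ((1 + C) * R) * ((1 + C) * R + R) := by gcongr
      _ ≤ ((1 + C) * R) * ((1 + C) * R + (1 + C) * R) := by gcongr; linarith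
      _ = 2 * ((1 + C) * R) ^ 2 := by ring
      _ ≤ (2 * (1 + C) * R) ^ 2 := by
        have := sq_nonneg ((1 + C) * R)
        linarith
  have hle := abs_le_of_sq_le_sq' hsq (by positivity)
  rw [aStar, ← hr, ← hξdef]
  refine one_div_le_one_div_of_le (by positivity) ?_
  linarith [hle.2]

end Asaga

theorem corollary3 :
    -- first part: step size `γ = a*(τ) / L`
    (∀ C : ℝ, 0 < C → ∃ c K : ℝ, 0 < c ∧ 0 < K ∧
      ∀ (n d : ℕ), 0 < n → 0 < d →
      ∀ (f : Fin n → Asaga.Vec d → ℝ) (L μ : ℝ), Asaga.IsProblem f L μ →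
      ∀ (xstar : Asaga.Vec d), (∀ x, Asaga.objective f xstar ≤ Asaga.objective f x) →
      ∀ (τ : ℕ), (τ : ℝ) ≤ n / 10 →
        (τ : ℝ) ≤ C * (1 / √(Asaga.sparsity f) * max 1 (n / (L / μ))) →
      ∃ ρ : ℝ, c * min (1 / (n : ℝ)) (1 / (L / μ)) ≤ ρ ∧ ρ < 1 ∧
        (∀ a : ℝ, 0 < a → a ≤ 1 → c * Asaga.sagaRate n (L / μ) a ≤ ρ) ∧
        ∀ (x₀ : Asaga.Vec d) (α₀ : Fin n → Asaga.Vec d),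
        (∀ i v, v ∉ Asaga.supp f i → α₀ i v = 0) →
        ∀ (γ : ℝ), γ = Asaga.aStar (L / μ) (Asaga.sparsity f) τ / L →
        ∀ (Ω : Type*) [MeasurableSpace Ω] (P : Measure Ω) [IsProbabilityMeasure P]
          (sched : Ω → Asaga.Schedule n d) (idx : ℕ → Ω → Fin n) (xhat : ℕ → Ω → Asaga.Vec d)
          (αhat : ℕ → Ω → Fin n → Asaga.Vec d),
          Asaga.IsRun f γ x₀ α₀ τ P sched idx xhat αhat →
          Asaga.ConvergesAtRate f xstar P xhat ρ
            (K * (n / γ) * Asaga.initialError f L xstar x₀ α₀)) ∧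
    -- second part: universal step size `γ = θ / L`
    (∀ C : ℝ, 0 < C → ∃ θ c K : ℝ, 0 < θ ∧ 0 < c ∧ 0 < K ∧
      ∀ (n d : ℕ), 0 < n → 0 < d →
      ∀ (f : Fin n → Asaga.Vec d → ℝ) (L μ : ℝ), Asaga.IsProblem f L μ →
      ∀ (xstar : Asaga.Vec d), (∀ x, Asaga.objective f xstar ≤ Asaga.objective f x) →
      ∀ (τ : ℕ), (τ : ℝ) ≤ C * (1 / √(Asaga.sparsity f)) →
      ∃ ρ : ℝ, c * min (1 / (n : ℝ)) (1 / (L / μ)) ≤ ρ ∧ ρ < 1 ∧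
        (∀ a : ℝ, 0 < a → a ≤ 1 → c * Asaga.sagaRate n (L / μ) a ≤ ρ) ∧
        ∀ (x₀ : Asaga.Vec d) (α₀ : Fin n → Asaga.Vec d),
        (∀ i v, v ∉ Asaga.supp f i → α₀ i v = 0) →
        ∀ (γ : ℝ), γ = θ / L →
        ∀ (Ω : Type*) [MeasurableSpace Ω] (P : Measure Ω) [IsProbabilityMeasure P]
          (sched : Ω → Asaga.Schedule n d) (idx : ℕ → Ω → Fin n) (xhat : ℕ → Ω → Asaga.Vec d)
          (αhat : ℕ → Ω → Fin n → Asaga.Vec d),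
          Asaga.IsRun f γ x₀ α₀ τ P sched idx xhat αhat →
          Asaga.ConvergesAtRate f xstar P xhat ρ
            (K * (n / γ) * Asaga.initialError f L xstar x₀ α₀)) := by
  constructor
  · intro C hC
    refine ⟨1 / (128 * (1 + C)), 5 / 2, by positivity, by norm_num, ?_⟩
    intro n d hn _ f L μ hf xstar hmin τ hτn hτC
    have hL := hf.L_pos
    have hμ := hf.mu_pos
    have hn1 : (1 : ℝ) ≤ n := by exact_mod_cast hn
    have hτ0 : (0 : ℝ) ≤ τ := by positivity
    set κ := L / μ with hκdef
    have hκ : 0 < κ := by positivity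
    obtain ⟨c, hc⟩ : ∃ c, c = 1 / (128 * (1 + C)) := ⟨_, rfl⟩
    have hc0 : 0 < c := by rw [hc]; positivity
    have hc1 : c ≤ 1 / 128 := by
      rw [hc]
      apply one_div_le_one_div_of_le <;> linarith
    rw [← hc]
    -- `c` is half the constant of the lower bound on `a*(τ)`, so that `ρ ≤ γμ/2`
    obtain ⟨ρ, hρ⟩ : ∃ ρ, ρ = c * min (1 / (n : ℝ)) (1 / κ) := ⟨_, rfl⟩
    have hρ0 : 0 ≤ ρ := by
      rw [hρ]; exact mul_nonneg hc0.le (le_min (by positivity) (by positivity))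
    have hρn : ρ ≤ 1 / 128 * (1 / n) := by
      rw [hρ]; exact mul_le_mul hc1 (min_le_left _ _) (le_min (by positivity) (by positivity))
        (by norm_num)
    have hn' : (1 : ℝ) / n ≤ 1 := by rw [div_le_one (by positivity)]; exact hn1
    refine ⟨ρ, hρ.ge, by linarith, fun a _ ha1 => ?_, ?_⟩
    · rw [hρ]; exact Asaga.mul_sagaRate_le hκ hc0.le ha1
    intro x₀ α₀ hα₀ γ hγ Ω _ P _ sched idx xhat αhat h
    obtain ⟨a, ha⟩ : ∃ a, a = Asaga.aStar κ (Asaga.sparsity f) τ := ⟨_, rfl⟩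
    have hlow := Asaga.le_aStar hκ hτ0 hC.le hτn hτC
    have hup := Asaga.aStar_mul_le (κ := κ) (Δ := Asaga.sparsity f) hκ hτ0 fun h0 => by
      rw [h0, div_zero, zero_mul, mul_zero] at hτC
      exact le_antisymm hτC hτ0
    rw [← ha] at hlow hup hγ
    have ha0 : 0 < a := lt_of_lt_of_le (by positivity) hlow
    have hγL : γ * L = a := by rw [hγ]; field_simp
    have hγμ : γ * μ = a / κ := by rw [hγ, hκdef]; field_simp
    have hγ0 : 0 < γ := by rw [hγ]; positivity
    have ha1 : a ≤ 1 := by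
      have h1 : 0 ≤ a * (τ * √(Asaga.sparsity f)) := by positivity
      have h2 : 0 ≤ a * (16 / 15 * τ * (√(Asaga.sparsity f) +
        a / κ * (1 + τ * √(Asaga.sparsity f)))) := by positivity
      linarith
    refine h.convergesAtRate hf hn hmin hα₀ hγ0 (hγL.trans_le ha1) hμ.le le_rfl hρ0 ?_ ?_ ?_
      (H := 1 / 5) (by linarith) ?_
    · -- `κ max(1, n/κ) = max(κ, n)`
      have h1 : min (1 / (n : ℝ)) (1 / κ) ≤ 1 / κ * (1 / max 1 (n / κ)) := by
        rcases le_total 1 ((n : ℝ) / κ) with hle | hle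
        · rw [max_eq_right hle]
          refine (min_le_left _ _).trans (le_of_eq ?_)
          field_simp
        · rw [max_eq_left hle]
          exact (min_le_right _ _).trans (le_of_eq (by ring))
      have h2 := mul_le_mul_of_nonneg_left h1 hc0.le
      have h3 := mul_le_mul_of_nonneg_left hlow (by positivity : 0 ≤ 1 / (2 * κ))
      rw [hρ, hγμ]
      refine h2.trans ((le_of_eq ?_).trans (h3.trans (le_of_eq ?_)))
      · rw [hc]; field_simp; norm_num
      · field_simp
    · have h1 : (1 : ℝ) / (20 * n) = 1 / 20 * (1 / n) := by field_simp
      have h2 : (0 : ℝ) ≤ 1 / n := by positivity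
      rw [h1]
      linarith
    · have h1 := mul_le_mul_of_nonneg_right hρn (by positivity : (0 : ℝ) ≤ 2 * τ + 1)
      have h2 : 1 / 128 * (1 / (n : ℝ)) * (2 * τ + 1) ≤ 1 / 128 * (1 / n) * (2 * n) := by
        gcongr
        linarith
      have h3 : 1 / 128 * (1 / (n : ℝ)) * (2 * n) = 1 / 64 := by field_simp; norm_num
      linarith
    · rw [hγL, hγμ]
      refine (mul_le_mul_of_nonneg_right hup (by norm_num)).trans (by norm_num)
  · intro C hC
    obtain ⟨θ, hθ⟩ : ∃ θ, θ = 1 / (32 * (1 + C) ^ 2) := ⟨_, rfl⟩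
    have hθ0 : 0 < θ := by rw [hθ]; positivity
    have hθC : θ * (1 + C) ^ 2 = 1 / 32 := by rw [hθ]; field_simp
    have hθC1 : θ * (1 + 2 * C) ≤ 1 / 32 := by
      rw [← hθC]
      exact mul_le_mul_of_nonneg_left (by nlinarith) hθ0.le
    have hθC2 : θ * (1 + C) ≤ 1 / 32 := le_trans (by nlinarith) hθC1
    have hθ1 : θ ≤ 1 / 32 := le_trans (by nlinarith) hθC1
    refine ⟨θ, θ / 2, 5 / 2, hθ0, by positivity, by norm_num, ?_⟩
    intro n d hn _ f L μ hf xstar hmin τ hτC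
    have hL := hf.L_pos
    have hμ := hf.mu_pos
    have hn1 : (1 : ℝ) ≤ n := by exact_mod_cast hn
    have hn' : (1 : ℝ) / n ≤ 1 := by rw [div_le_one (by positivity)]; exact hn1
    have hτ0 : (0 : ℝ) ≤ τ := by positivity
    obtain ⟨ρ, hρ⟩ : ∃ ρ, ρ = θ / 2 * min (1 / (n : ℝ)) (1 / (L / μ)) := ⟨_, rfl⟩
    have hρ0 : 0 ≤ ρ := by
      rw [hρ]; exact mul_nonneg (by positivity) (le_min (by positivity) (by positivity))
    have hρn : ρ ≤ θ / 2 * (1 / n) := by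
      rw [hρ]; exact mul_le_mul_of_nonneg_left (min_le_left _ _) (by positivity)
    have hρn' : ρ ≤ 1 / 64 * (1 / n) := hρn.trans
      (mul_le_mul_of_nonneg_right (by linarith) (by positivity))
    refine ⟨ρ, hρ.ge, by linarith, fun a _ ha1 => ?_, ?_⟩
    · rw [hρ]; exact Asaga.mul_sagaRate_le (by positivity) (by positivity) ha1
    intro x₀ α₀ hα₀ γ hγ Ω _ P _ sched idx xhat αhat h
    have hγ0 : 0 < γ := by rw [hγ]; positivity
    have hγL : γ * L = θ := by rw [hγ]; field_simp
    set r := √(Asaga.sparsity f) with hr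
    have hr0 : 0 ≤ r := Real.sqrt_nonneg _
    have hτr : τ * r ≤ C := Asaga.mul_le_of_le_one_div_mul hr0 hC.le (hτC.trans (le_of_eq (by ring)))
    have hτn : (τ : ℝ) ≤ C * n := by
      refine hτC.trans (mul_le_mul_of_nonneg_left ?_ hC.le)
      rcases Asaga.sparsity_eq_zero_or f with h0 | h0
      · rw [hr, h0, Real.sqrt_zero, div_zero]; positivity
      · have h1 : 1 / (n : ℝ) ≤ r := by
          refine Real.le_sqrt_of_sq_le (le_trans ?_ h0)
          rw [sq]
          exact mul_le_of_le_one_left (by positivity) hn'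
        rw [one_div_le (lt_of_lt_of_le (by positivity) h1) (by positivity)]
        exact h1
    -- only the strong convexity modulus `min μ (L / n)` is used, and `ρ = γσ/2` for this `σ`
    obtain ⟨σ, hσ⟩ : ∃ σ, σ = min μ (L / n) := ⟨_, rfl⟩
    have hσ0 : 0 ≤ σ := by rw [hσ]; exact le_min hμ.le (by positivity)
    have hγσ : γ * σ ≤ θ * (1 / n) := by
      have h1 : σ ≤ L / n := by rw [hσ]; exact min_le_right _ _
      refine (mul_le_mul_of_nonneg_left h1 hγ0.le).trans (le_of_eq ?_)
      rw [← hγL]; ring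
    refine h.convergesAtRate hf hn hmin hα₀ hγ0 (by rw [hγL]; linarith) hσ0
      (by rw [hσ]; exact min_le_left _ _) hρ0 ?_ ?_ ?_ (H := 2 * C) (by linarith) ?_
    · have h1 : σ = L * min (1 / (n : ℝ)) (1 / (L / μ)) := by
        rw [hσ, mul_min_of_nonneg _ _ hL.le, min_comm]
        congr 1 <;> field_simp
      rw [h1, ← mul_assoc, hγL, hρ]
      exact le_of_eq (by ring)
    · have h1 : (1 : ℝ) / (20 * n) = 1 / 20 * (1 / n) := by field_simp
      have h2 : (0 : ℝ) ≤ 1 / n := by positivity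
      rw [h1]
      linarith
    · have h1 := mul_le_mul_of_nonneg_right hρn (by positivity : (0 : ℝ) ≤ 2 * τ + 1)
      have h2 : θ / 2 * (1 / (n : ℝ)) * (2 * τ + 1) ≤ θ / 2 * (1 / n) * ((1 + 2 * C) * n) := by
        gcongr
        linarith
      have h3 : θ / 2 * (1 / (n : ℝ)) * ((1 + 2 * C) * n) = θ * (1 + 2 * C) / 2 := by field_simp
      linarith
    · have h1 : τ * (γ * σ * (1 + τ * r)) ≤ 1 / 32 * C := by
        calc τ * (γ * σ * (1 + τ * r)) ≤ C * n * (θ * (1 / n) * (1 + C)) := by gcongr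
          _ = θ * (1 + C) * C := by field_simp
          _ ≤ 1 / 32 * C := mul_le_mul_of_nonneg_right hθC2 hC.le
      have h2 : (1 + τ * r) + 16 / 15 * τ * (r + γ * σ * (1 + τ * r)) ≤ 21 / 10 * (1 + C) := by
        linarith
      have h3 : 4 + 64 / 15 * (2 * C + 5 / 4) ≤ 28 / 3 * (1 + C) := by linarith
      rw [hγL]
      calc θ * ((1 + τ * r) + 16 / 15 * τ * (r + γ * σ * (1 + τ * r))) *
            (4 + 64 / 15 * (2 * C + 5 / 4))
          ≤ θ * (21 / 10 * (1 + C)) * (28 / 3 * (1 + C)) := by gcongr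
        _ = 98 / 5 * (θ * (1 + C) ^ 2) := by ring
        _ ≤ 1 := by rw [hθC]; norm_num
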